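/- Let $G=(V,E)$ be a finite undirected graph with edge weights $w(e)\ge 0$, and let $A,B,C\subseteq V$ be pairwise disjoint sets of boundary vertices. Let $n\ge 2$ be an integer and $m\ge 2$ an even integer. Permutations. Let $S_{mn}$ be the group of permutations of the $mn$ replicas $(k,\ell)$, $1\le k\le n$, $1\le \ell\le m$, with Cayley distance $d(g,h)=mn-\#(gh^{-1})$, where $\#(\cdot)$ counts cycles (fixed points included). Let $g_B$ be the permutation $(k,\ell)\mapsto(k,\ell+1)$ ($\ell$ cyclic modulo $m$), let $\tau$ be the permutation $(k,\ell)\mapsto(k+1,\ell)$ ($k$ cyclic modulo $n$) for $\ell>m/2$ which fixes $(k,\ell)$ for $\ell\le m/2$, and put $g_A=\tau^{-1}g_B\tau$. Let $X$ be the permutation that, for every $k$, cyclically permutes $(k,1),\dots,(k,m/2)$ and cyclically permutes $(k,m/2+1),\dots,(k,m)$. The program $R$. A configuration is a map $g:V\to S_{mn}$ with $g=g_A$ on $A$, $g=g_B$ on $B$ and $g=\mathrm{id}$ on $C$. It is optimal if it minimizes $$R(g)=\sum_{e=\{x,y\}\in E}w(e)\,d(g(x),g(y))$$ among all configurations. Cuts.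 For $r_1,r_2\subseteq V$ let $\mu(r_1:r_2)$ be the set of edges that meet both $r_1$ and $r_2$, and for $S\subseteq E$ let $w(S)=\sum_{e\in S}w(e)$. A minimal cut for $AB:C$ is a set $r\subseteq V$ with $A\cup B\subseteq r$ and $C\subseteq V\setminus r$ that minimizes $w(\mu(r:V\setminus r))$ among all such sets. An optimal triway cut for $A:B:C$ is a triple $(\alpha,\beta,\gamma)$ with $V=\alpha\sqcup\beta\sqcup\gamma$, $A\subseteq\alpha$, $B\subseteq\beta$, $C\subseteq\gamma$ that minimizes $$2(n-1)\,w(\mu(\alpha:\beta))+n\,w(\mu(\beta:\gamma))+n\,w(\mu(\gamma:\alpha))$$ among all such triples. Theorem. Suppose that the optimal triway cut $(r_A,r_B,r_C)$ for $A:B:C$ is unique and that the minimal cut $r_{AB}$ for $AB:C$ is unique. Then there is exactly one optimal configuration $g:V\to S_{mn}$ of the program $R$, and it satisfies, for every $v\in V$, $$g(v)=\begin{cases} g_A, & v\in r_A,\\ g_B, & v\in r_B,\\ X, & v\in r_{AB}\setminus(r_A\cup r_B),\\ \mathrm{id}, & v\in V\setminus r_{AB}.\end{cases}$$ -/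

import Mathlib

namespace ReflectedEntropy

/-! ### Permutations of the replicas -/

/-- The number `#(σ)` of cycles of a permutation, fixed points included. -/
noncomputable def cycleCount {α : Type*} (σ : Equiv.Perm α) : ℕ :=
  Nat.card (Quotient (Equiv.Perm.SameCycle.setoid σ))

/-- The Cayley distance `d(g, h) = N - #(g h⁻¹)` on the permutations of `N` letters. -/
noncomputable def cayleyDist {α : Type*} (g h : Equiv.Perm α) : ℝ :=
  (Nat.card α : ℝ) - (cycleCount (g * h⁻¹) : ℝ)

theorem cayleyDist_comm {α : Type*} (g h : Equiv.Perm α) :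
    cayleyDist g h = cayleyDist h g := by
  have key : Equiv.Perm.SameCycle.setoid (g * h⁻¹) = Equiv.Perm.SameCycle.setoid (h * g⁻¹) := by
    ext x y
    change (g * h⁻¹).SameCycle x y ↔ (h * g⁻¹).SameCycle x y
    rw [← Equiv.Perm.sameCycle_inv, mul_inv_rev, inv_inv]
  unfold cayleyDist cycleCount
  rw [key]

/-- The `m n` replicas are labelled by pairs `(k, ℓ)`, both coordinates counted from `0`;
`S_{mn}` is the group of permutations of these pairs. -/
abbrev ReplicaPerm (n m : ℕ) : Type := Equiv.Perm (Fin n × Fin m)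

/-- `g_B` shifts `(k, ℓ) ↦ (k, ℓ + 1)`, cyclically in `ℓ`. -/
def gB (n m : ℕ) : ReplicaPerm n m :=
  Equiv.prodCongr (Equiv.refl (Fin n)) (finRotate m)

/-- `γ` shifts `(k, ℓ) ↦ (k + 1, ℓ)`, cyclically in `k`, for `ℓ` in the second half of the
`m` values, and fixes the other pairs. -/
def lowerShift (n m : ℕ) : ReplicaPerm n m where
  toFun p := (if m / 2 ≤ p.2.val then finRotate n p.1 else p.1, p.2)
  invFun p := (if m / 2 ≤ p.2.val then (finRotate n).symm p.1 else p.1, p.2)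
  left_inv := by
    rintro ⟨k, l⟩
    by_cases h : m / 2 ≤ l.val
    · simp only [h, if_true, Equiv.symm_apply_apply]
    · simp only [h, if_false]
  right_inv := by
    rintro ⟨k, l⟩
    by_cases h : m / 2 ≤ l.val
    · simp only [h, if_true, Equiv.apply_symm_apply]
    · simp only [h, if_false]

/-- `g_A = γ⁻¹ g_B γ`. -/
def gA (n m : ℕ) : ReplicaPerm n m :=
  (lowerShift n m)⁻¹ * gB n m * lowerShift n m

/-- The cyclic permutation of the first `m / 2` elements of `Fin m`. -/
def upperHalfCycle (m : ℕ) : Equiv.Perm (Fin m) :=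
  ((List.finRange m).filter (fun l => l.val < m / 2)).formPerm

/-- The cyclic permutation of the remaining elements of `Fin m`. -/
def lowerHalfCycle (m : ℕ) : Equiv.Perm (Fin m) :=
  ((List.finRange m).filter (fun l => m / 2 ≤ l.val)).formPerm

/-- `X` cyclically permutes each of the two halves of each of the `n` rows. -/
def gX (n m : ℕ) : ReplicaPerm n m :=
  Equiv.prodCongr (Equiv.refl (Fin n)) (upperHalfCycle m * lowerHalfCycle m)

/-! ### Weighted graphs and cuts -/

section Graph

variable {V : Type*} [Finite V] (G : SimpleGraph V) (w : Sym2 V → ℝ)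

/-- `E[r]`: the edges with some endpoint in `r`. -/
def edgesMeeting (r : Set V) : Set (Sym2 V) :=
  {e | e ∈ G.edgeSet ∧ ∃ v ∈ r, v ∈ e}

/-- `μ(r₁ : r₂) = E[r₁] ∩ E[r₂]`. -/
def cutSurface (r₁ r₂ : Set V) : Set (Sym2 V) :=
  edgesMeeting G r₁ ∩ edgesMeeting G r₂

/-- `w(S)`: the total weight of a set of edges. -/
noncomputable def totalWeight (S : Set (Sym2 V)) : ℝ :=
  ∑ e ∈ (Set.toFinite S).toFinset, w e

/-- `r` is a cut for `S : T`. -/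
def IsCut (S T r : Set V) : Prop := S ⊆ r ∧ T ⊆ rᶜ

/-- `r` is a minimal cut for `S : T`. -/
def IsMinCut (S T r : Set V) : Prop :=
  IsCut S T r ∧ ∀ r' : Set V, IsCut S T r' →
    totalWeight w (cutSurface G r rᶜ) ≤ totalWeight w (cutSurface G r' r'ᶜ)

/-- `r` is the only minimal cut for `S : T`. -/
def IsUniqueMinCut (S T r : Set V) : Prop :=
  IsMinCut G w S T r ∧ ∀ r' : Set V, IsMinCut G w S T r' → r' = r

/-- `V = α ⊔ β ⊔ γ` with `A ⊆ α`, `B ⊆ β` and `C ⊆ γ`. -/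
def IsTriwayCut (A B C α β γ : Set V) : Prop :=
  (α ∪ β ∪ γ = Set.univ ∧ Disjoint α β ∧ Disjoint β γ ∧ Disjoint γ α) ∧
    A ⊆ α ∧ B ⊆ β ∧ C ⊆ γ

/-- The area of `(α, β, γ)` with tensions `tAB`, `tBC`, `tCA`. -/
noncomputable def triwayArea (tAB tBC tCA : ℝ) (α β γ : Set V) : ℝ :=
  tAB * totalWeight w (cutSurface G α β) + tBC * totalWeight w (cutSurface G β γ)
    + tCA * totalWeight w (cutSurface G γ α)

/-- `(α, β, γ)` is an optimal solution of the triway cut problem. -/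
def IsMinTriwayCut (tAB tBC tCA : ℝ) (A B C α β γ : Set V) : Prop :=
  IsTriwayCut A B C α β γ ∧ ∀ α' β' γ' : Set V, IsTriwayCut A B C α' β' γ' →
    triwayArea G w tAB tBC tCA α β γ ≤ triwayArea G w tAB tBC tCA α' β' γ'

/-- `(α, β, γ)` is the only optimal solution of the triway cut problem. -/
def IsUniqueMinTriwayCut (tAB tBC tCA : ℝ) (A B C α β γ : Set V) : Prop :=
  IsMinTriwayCut G w tAB tBC tCA A B C α β γ ∧
    ∀ α' β' γ' : Set V, IsMinTriwayCut G w tAB tBC tCA A B C α' β' γ' →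
      α' = α ∧ β' = β ∧ γ' = γ

/-! ### The reflected entropy optimization `R` -/

/-- `R(g) = ∑_{e = {x, y} ∈ E} w(e) d(g(x), g(y))`. -/
noncomputable def freeEnergy {n m : ℕ} (g : V → ReplicaPerm n m) : ℝ :=
  ∑ e ∈ (Set.toFinite G.edgeSet).toFinset,
    w e * Sym2.lift ⟨fun x y => cayleyDist (g x) (g y), fun _ _ => cayleyDist_comm _ _⟩ e

/-- The boundary conditions `g(A) = g_A`, `g(B) = g_B`, `g(C) = id`. -/
def IsConfiguration {n m : ℕ} (A B C : Set V) (g : V → ReplicaPerm n m) : Prop :=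
  (∀ v ∈ A, g v = gA n m) ∧ (∀ v ∈ B, g v = gB n m) ∧ (∀ v ∈ C, g v = 1)

/-- `g` is an optimal solution of `R`. -/
def IsOptimalConfiguration {n m : ℕ} (A B C : Set V) (g : V → ReplicaPerm n m) : Prop :=
  IsConfiguration A B C g ∧ ∀ g' : V → ReplicaPerm n m, IsConfiguration A B C g' →
    freeEnergy G w g ≤ freeEnergy G w g'

end Graph

end ReflectedEntropy

/-! The Cayley distance is bounded below by an average of cut functions. Put h = m/2 and K =
4n(n-1), and count columns from 0. Right multiplication by X⁻¹ preserves distances; it turns g_A and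
g_B into two perfect matchings P and Q between the columns 0 and h, X into 1, and id into X⁻¹.

Two mechanisms turn a configuration into cuts. First, the N = n(m-2) bulk replicas, those outside
the columns 0 and h, are removed from the cycles one at a time. A removal never increases a
distance, and lowers it by at least one if exactly one of the two permutations moves the removed
point (`len_bypass_mul_inv_add_le`). Since P and Q fix the bulk, while X⁻¹ moves each bulk point at
its turn, each removal yields a cut for AB:C. Second, what remains has boundary values P, Q, 1. With
a mass s depending on the length and a bias d depending on the distances to P and Q, such a
permutation gets the label 0 at s+d of K thresholds, the label 1 at s-d of them, and the label 2 at
the others. Each threshold yields a triway cut, and the tensions of the labels, summed over the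
thresholds, are at most K times the distance (`IsReplicaPair.sum_tension_le`). It is enough to check
this across one transposition. The delicate case is a geodesic from P to Q: all its points have
length at least n, so the label 2 is absent there and only the tension 2(n-1) is paid.

Summing over edges gives R(g) ≥ (triway area) + N (cut weight). The stated configuration attains
this bound; that it satisfies the boundary conditions rests on r_A ∪ r_B ⊆ r_AB, an exchange
argument (`union_subset_minCut`).

In the case of equality, all the cuts are the unique ones. Inside r_AB no bulk point is moved, and
the labels at the two extreme thresholds identify g_A, g_B and X. Outside r_AB the labels do not
determine g, but equality on every edge makes g constant across edges of positive weight there, and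
the uniqueness of r_AB then forces the identity. -/

namespace ReflectedEntropy

/-! ### Cayley length as the codimension of the space of invariant functions -/

section Length

variable {α : Type*}

theorem perm_apply_inv_apply (σ : Equiv.Perm α) (x : α) : σ (σ⁻¹ x) = x :=
  σ.apply_symm_apply x

theorem perm_inv_apply_apply (σ : Equiv.Perm α) (x : α) : σ⁻¹ (σ x) = x :=
  σ.symm_apply_apply x

theorem apply_eq_of_sameCycle {β : Type*} {σ : Equiv.Perm α} {φ : α → β}
    (h : ∀ x, φ (σ x) = φ x) {x y : α} (hxy : σ.SameCycle x y) : φ x = φ y := by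
  obtain ⟨i, rfl⟩ := hxy
  have hinv : ∀ z, φ (σ⁻¹ z) = φ z := fun z => by
    rw [← h (σ⁻¹ z), perm_apply_inv_apply]
  induction i using Int.induction_on with
  | zero => simp
  | succ i ih => rw [add_comm, zpow_add, zpow_one, Equiv.Perm.mul_apply, h]; exact ih
  | pred i ih =>
    rw [sub_eq_add_neg, add_comm, zpow_add, zpow_neg_one, Equiv.Perm.mul_apply, hinv]; exact ih

theorem sameCycle_of_semiconj {β : Type*} {σ : Equiv.Perm α} {ρ : Equiv.Perm β} (f : β → α)
    (h : ∀ x, σ (f x) = f (ρ x)) {x y : β} (hxy : ρ.SameCycle x y) :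
    σ.SameCycle (f x) (f y) := by
  refine Quotient.exact (s := Equiv.Perm.SameCycle.setoid σ) ?_
  refine apply_eq_of_sameCycle
    (φ := fun z => Quotient.mk (Equiv.Perm.SameCycle.setoid σ) (f z)) (fun z => ?_) hxy
  refine Quotient.sound (s := Equiv.Perm.SameCycle.setoid σ) ?_
  change σ.SameCycle (f (ρ z)) (f z)
  rw [← h, Equiv.Perm.sameCycle_apply_left]

/-- The functions that are constant along the cycles of `σ`. -/
def invariants (σ : Equiv.Perm α) : Submodule ℚ (α → ℚ) where
  carrier := {f | ∀ x, f (σ x) = f x}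
  add_mem' hf hg x := by simp only [Pi.add_apply, hf x, hg x]
  zero_mem' _ := rfl
  smul_mem' c f hf x := by simp only [Pi.smul_apply, hf x]

theorem mem_invariants {σ : Equiv.Perm α} {f : α → ℚ} :
    f ∈ invariants σ ↔ ∀ x, f (σ x) = f x := Iff.rfl

/-- Invariant functions are the functions on the set of cycles. -/
def invariantsEquiv (σ : Equiv.Perm α) :
    (Quotient (Equiv.Perm.SameCycle.setoid σ) → ℚ) ≃ₗ[ℚ] invariants σ where
  toFun F := ⟨fun x => F (Quotient.mk _ x), fun x => congrArg F (Quotient.sound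
    (s := Equiv.Perm.SameCycle.setoid σ)
    (show σ.SameCycle (σ x) x by rw [Equiv.Perm.sameCycle_apply_left]))⟩
  map_add' _ _ := rfl
  map_smul' _ _ := rfl
  invFun f := Quotient.lift f.1 fun _ _ h => apply_eq_of_sameCycle f.2 h
  left_inv F := by
    funext q
    induction q using Quotient.inductionOn with
    | h x => rfl
  right_inv _ := rfl

theorem inf_invariants_le (σ τ : Equiv.Perm α) :
    invariants σ ⊓ invariants τ ≤ invariants (σ * τ) := by
  rintro f ⟨h1, h2⟩ x
  rw [Equiv.Perm.mul_apply, h1, h2]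

theorem invariants_inv (σ : Equiv.Perm α) : invariants σ⁻¹ = invariants σ := by
  ext f
  refine ⟨fun h x => ?_, fun h x => ?_⟩
  · rw [← h (σ x), perm_inv_apply_apply]
  · rw [← h (σ⁻¹ x), perm_apply_inv_apply]

section Bypass

variable [DecidableEq α]

theorem apply_swap_of_eq {β : Type*} {f : α → β} {x y : α} (h : f x = f y) (z : α) :
    f (Equiv.swap x y z) = f z := by
  rw [Equiv.swap_apply_def]
  split_ifs with h1 h2
  · rw [h1, h]
  · rw [h2, h]
  · rfl

/-- Remove `i` from the cycle of `σ` that contains it. -/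
def bypass (i : α) (σ : Equiv.Perm α) : Equiv.Perm α := Equiv.swap i (σ i) * σ

theorem bypass_apply_self (i : α) (σ : Equiv.Perm α) : bypass i σ i = i := by
  simp [bypass]

theorem bypass_of_fixed {i : α} {σ : Equiv.Perm α} (h : σ i = i) : bypass i σ = σ := by
  rw [bypass, h, Equiv.swap_self]; rfl

theorem bypass_apply_of_fixed {i j : α} {σ : Equiv.Perm α} (h : σ j = j) :
    bypass i σ j = j := by
  by_cases hij : j = i
  · rw [hij, bypass_apply_self]
  · rw [bypass, Equiv.Perm.mul_apply, h, Equiv.swap_apply_of_ne_of_ne hij]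
    intro h2
    exact hij (σ.injective (h.trans h2))

theorem apply_bypass {β : Type*} {φ : α → β} {σ : Equiv.Perm α} (h : ∀ x, φ (σ x) = φ x)
    (i x : α) : φ (bypass i σ x) = φ x := by
  rw [bypass, Equiv.Perm.mul_apply, apply_swap_of_eq (h i).symm, h]

end Bypass

variable [Fintype α]

theorem finrank_le_finrank_inf_ker_add_one (W : Submodule ℚ (α → ℚ)) (φ : (α → ℚ) →ₗ[ℚ] ℚ) :
    Module.finrank ℚ W ≤ Module.finrank ℚ (W ⊓ LinearMap.ker φ : Submodule ℚ (α → ℚ)) + 1 := by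
  have h4 := Submodule.finrank_sup_add_finrank_inf_eq W (LinearMap.ker φ)
  have h5 := LinearMap.finrank_range_add_finrank_ker φ
  have h6 := Submodule.finrank_le (W ⊔ LinearMap.ker φ)
  have h7 := Submodule.finrank_le (LinearMap.range φ)
  rw [Module.finrank_self] at h7
  omega

theorem finrank_invariants (σ : Equiv.Perm α) :
    Module.finrank ℚ (invariants σ) = cycleCount σ := by
  classical
  have : Fintype (Quotient (Equiv.Perm.SameCycle.setoid σ)) := Fintype.ofFinite _
  rw [← (invariantsEquiv σ).finrank_eq, Module.finrank_fintype_fun_eq_card, cycleCount,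
    Nat.card_eq_fintype_card]

/-- The Cayley distance of `σ` from the identity. -/
noncomputable def len (σ : Equiv.Perm α) : ℕ := Nat.card α - cycleCount σ

theorem len_add_finrank (σ : Equiv.Perm α) :
    len σ + Module.finrank ℚ (invariants σ) = Nat.card α := by
  have := Submodule.finrank_le (invariants σ)
  rw [Module.finrank_fintype_fun_eq_card, ← Nat.card_eq_fintype_card] at this
  rw [len, ← finrank_invariants]
  omega

theorem cayleyDist_eq_len (g h : Equiv.Perm α) : cayleyDist g h = (len (g * h⁻¹) : ℝ) := by
  have := len_add_finrank (g * h⁻¹)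
  rw [cayleyDist, ← finrank_invariants, ← this]
  push_cast
  ring

theorem len_inv (σ : Equiv.Perm α) : len σ⁻¹ = len σ := by
  have h1 := len_add_finrank σ
  have h2 := len_add_finrank σ⁻¹
  rw [invariants_inv] at h2
  omega

theorem len_mul_inv_comm (g h : Equiv.Perm α) : len (g * h⁻¹) = len (h * g⁻¹) := by
  rw [← len_inv, mul_inv_rev, inv_inv]

theorem len_one : len (1 : Equiv.Perm α) = 0 := by
  have h1 := len_add_finrank (1 : Equiv.Perm α)
  have : invariants (1 : Equiv.Perm α) = ⊤ := by
    ext f; simp [mem_invariants]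
  rw [this, finrank_top, Module.finrank_fintype_fun_eq_card, ← Nat.card_eq_fintype_card] at h1
  omega

/-- A function invariant under both factors is invariant under the product, and the codimension of
an intersection is at most the sum of the codimensions. -/
theorem len_mul_le (σ τ : Equiv.Perm α) : len (σ * τ) ≤ len σ + len τ := by
  have h1 := len_add_finrank σ
  have h2 := len_add_finrank τ
  have h3 := len_add_finrank (σ * τ)
  have h4 := Submodule.finrank_sup_add_finrank_inf_eq (invariants σ) (invariants τ)
  have h5 := Submodule.finrank_mono (inf_invariants_le σ τ)
  have h6 := Submodule.finrank_le (invariants σ ⊔ invariants τ)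
  rw [Module.finrank_fintype_fun_eq_card, ← Nat.card_eq_fintype_card] at h6
  omega

/-- On a geodesic, functions invariant under the product are invariant under the factors. -/
theorem invariants_mul_le_left {σ τ : Equiv.Perm α} (h : len σ + len τ ≤ len (σ * τ)) :
    invariants (σ * τ) ≤ invariants σ := by
  have h1 := len_add_finrank σ
  have h2 := len_add_finrank τ
  have h3 := len_add_finrank (σ * τ)
  have h4 := Submodule.finrank_sup_add_finrank_inf_eq (invariants σ) (invariants τ)
  have h6 := Submodule.finrank_le (invariants σ ⊔ invariants τ)
  rw [Module.finrank_fintype_fun_eq_card, ← Nat.card_eq_fintype_card] at h6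
  -- Additivity of the lengths leaves no slack in the dimension count, so the inclusion is an
  -- equality.
  rw [← Submodule.eq_of_le_of_finrank_le (inf_invariants_le σ τ) (by omega)]
  exact inf_le_left

theorem len_triangle (g h k : Equiv.Perm α) :
    len (g * k⁻¹) ≤ len (g * h⁻¹) + len (h * k⁻¹) := by
  have := len_mul_le (g * h⁻¹) (h * k⁻¹)
  simpa [mul_assoc] using this

/-- An invariant idempotent choice of a representative in each cycle determines the length. -/
theorem len_eq_card_of_representative {σ : Equiv.Perm α} (φ : α → α)
    (h1 : ∀ x, σ.SameCycle x (φ x)) (h2 : ∀ x, φ (σ x) = φ x) :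
    len σ = Nat.card {x // φ x ≠ x} := by
  classical
  have key : cycleCount σ = Nat.card {x // φ x = x} := by
    refine Nat.card_congr
      { toFun := Quotient.lift (fun x => ⟨φ x, (apply_eq_of_sameCycle h2 (h1 x)).symm⟩)
          fun x y hxy => Subtype.ext (apply_eq_of_sameCycle h2 hxy)
        invFun := fun x => Quotient.mk _ x.1
        left_inv := fun q => ?_
        right_inv := fun x => Subtype.ext x.2 }
    induction q using Quotient.inductionOn with
    | h x => exact Quotient.sound (s := Equiv.Perm.SameCycle.setoid σ) (h1 x).symm
  have := Fintype.card_subtype_compl (fun x => φ x = x)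
  rw [len, key, Nat.card_eq_fintype_card, Nat.card_eq_fintype_card, Nat.card_eq_fintype_card]
  exact this.symm

/-- If every cycle meets the complement of `p`, then the length is at least the size of `p`. -/
theorem card_le_len {σ : Equiv.Perm α} (p : α → Prop)
    (h : ∀ x, p x → ∃ y, ¬ p y ∧ σ.SameCycle y x) : Nat.card {x // p x} ≤ len σ := by
  classical
  have key : cycleCount σ ≤ Nat.card {x // ¬ p x} := by
    refine Nat.card_le_card_of_surjective
      (fun x : {x // ¬ p x} => Quotient.mk (Equiv.Perm.SameCycle.setoid σ) x.1) fun q => ?_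
    induction q using Quotient.inductionOn with
    | h x =>
      by_cases hx : p x
      · obtain ⟨y, hy, hyx⟩ := h x hx
        exact ⟨⟨y, hy⟩, Quotient.sound (s := Equiv.Perm.SameCycle.setoid σ) hyx⟩
      · exact ⟨⟨x, hx⟩, rfl⟩
  have h2 := Fintype.card_subtype_compl p
  have h3 := Fintype.card_subtype_le p
  rw [len]
  rw [Nat.card_eq_fintype_card] at *
  rw [Nat.card_eq_fintype_card]
  omega

/-- The single linear condition `f x = f y` costs at most one dimension of invariants. -/
theorem len_le_of_forall {σ π : Equiv.Perm α} (x y : α)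
    (h : ∀ f ∈ invariants σ, f x = f y → f ∈ invariants π) : len π ≤ len σ + 1 := by
  have h1 := len_add_finrank σ
  have h2 := len_add_finrank π
  have h3 := finrank_le_finrank_inf_ker_add_one (invariants σ)
    (LinearMap.proj (R := ℚ) (φ := fun _ : α => ℚ) x - LinearMap.proj y)
  have h4 : invariants σ ⊓ LinearMap.ker (LinearMap.proj (R := ℚ) (φ := fun _ : α => ℚ) x
      - LinearMap.proj y) ≤ invariants π := by
    rintro f ⟨hf, hk⟩
    exact h f hf (sub_eq_zero.1 hk)
  have h5 := Submodule.finrank_mono h4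
  omega

variable [DecidableEq α]

theorem len_swap_mul_le (σ : Equiv.Perm α) (x y : α) :
    len (Equiv.swap x y * σ) ≤ len σ + 1 :=
  len_le_of_forall x y fun f hf hxy z => by
    rw [Equiv.Perm.mul_apply, apply_swap_of_eq hxy, hf]

/-- The indicator of `i` becomes a new invariant, so the length drops; one transposition restores
`σ`, so it drops by no more than one. -/
theorem len_bypass_add_one {i : α} {σ : Equiv.Perm α} (h : σ i ≠ i) :
    len (bypass i σ) + 1 = len σ := by
  have h1 := len_add_finrank σ
  have h2 := len_add_finrank (bypass i σ)
  have h3 : invariants σ < invariants (bypass i σ) := by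
    refine SetLike.lt_iff_le_and_exists.2 ⟨fun f hf x => apply_bypass hf i x,
      Pi.single i 1, fun x => ?_, fun hf => ?_⟩
    · by_cases hx : x = i
      · rw [hx, bypass_apply_self]
      · have : bypass i σ x ≠ i := fun h' =>
          hx ((bypass i σ).injective (h'.trans (bypass_apply_self i σ).symm))
        rw [Pi.single_eq_of_ne this, Pi.single_eq_of_ne hx]
    · have := hf i
      rw [Pi.single_eq_same, Pi.single_eq_of_ne h] at this
      exact zero_ne_one this
  have h4 := Submodule.finrank_lt_finrank_of_lt h3
  have h5 := len_swap_mul_le (bypass i σ) i (σ i)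
  have h6 : Equiv.swap i (σ i) * bypass i σ = σ := by
    rw [bypass, ← mul_assoc, Equiv.swap_mul_self, one_mul]
  rw [h6] at h5
  omega

theorem eq_one_of_len_eq_zero {σ : Equiv.Perm α} (h : len σ = 0) : σ = 1 := by
  by_contra hne
  obtain ⟨i, hi⟩ : ∃ i, σ i ≠ i := by
    by_contra hcon
    push Not at hcon
    exact hne (Equiv.ext hcon)
  have := len_bypass_add_one hi
  omega

theorem exists_moved_of_len_pos {σ : Equiv.Perm α} (h : len σ ≠ 0) : ∃ i, σ i ≠ i := by
  by_contra hcon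
  push Not at hcon
  rw [show σ = 1 from Equiv.ext hcon, len_one] at h
  exact h rfl

theorem sign_eq_neg_one_pow_len (σ : Equiv.Perm α) : Equiv.Perm.sign σ = (-1) ^ len σ := by
  induction hk : len σ generalizing σ with
  | zero => rw [eq_one_of_len_eq_zero hk, map_one, pow_zero]
  | succ k ih =>
    obtain ⟨i, hi⟩ := exists_moved_of_len_pos (σ := σ) (by omega)
    have h1 := len_bypass_add_one hi
    have h2 := ih (bypass i σ) (by omega)
    rw [bypass, map_mul, Equiv.Perm.sign_swap hi.symm] at h2
    rw [pow_succ, ← h2]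
    simp

theorem even_iff_of_sign_eq {σ τ : Equiv.Perm α}
    (h : Equiv.Perm.sign σ = Equiv.Perm.sign τ) : Even (len σ) ↔ Even (len τ) := by
  rw [sign_eq_neg_one_pow_len, sign_eq_neg_one_pow_len] at h
  rcases Nat.even_or_odd (len σ) with h1 | h1 <;> rcases Nat.even_or_odd (len τ) with h2 | h2
  · simp [h1, h2]
  · rw [h1.neg_one_pow, h2.neg_one_pow] at h
    exact absurd h (by decide)
  · rw [h1.neg_one_pow, h2.neg_one_pow] at h
    exact absurd h (by decide)
  · simp [Nat.not_even_iff_odd.2 h1, Nat.not_even_iff_odd.2 h2]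

theorem even_len_mul (σ τ : Equiv.Perm α) : Even (len (σ * τ) + (len σ + len τ)) := by
  have h : ((-1 : ℤˣ)) ^ (len (σ * τ) + (len σ + len τ)) = 1 := by
    rw [pow_add, pow_add, ← sign_eq_neg_one_pow_len, ← sign_eq_neg_one_pow_len,
      ← sign_eq_neg_one_pow_len, map_mul]
    exact Int.units_mul_self _
  rcases Nat.even_or_odd (len (σ * τ) + (len σ + len τ)) with h1 | h1
  · exact h1
  · rw [h1.neg_one_pow] at h
    exact absurd h (by decide)

theorem even_len_triangle (g h k : Equiv.Perm α) :
    Even (len (g * k⁻¹) + (len (g * h⁻¹) + len (h * k⁻¹))) := by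
  simpa [mul_assoc] using even_len_mul (g * h⁻¹) (h * k⁻¹)

/-- Removing a point contracts the Cayley distance, and strictly so if the point is fixed by
exactly one of the two permutations. -/
theorem len_bypass_mul_inv_add_le (i : α) (g h : Equiv.Perm α) :
    len (bypass i g * (bypass i h)⁻¹) + (if (g i = i ↔ h i = i) then 0 else 1)
      ≤ len (g * h⁻¹) := by
  by_cases hg : g i = i <;> by_cases hh : h i = i
  · simp [hg, hh, bypass_of_fixed]
  · have h1 : (h * g⁻¹) i = h i := by
      rw [Equiv.Perm.mul_apply, Equiv.Perm.inv_eq_iff_eq.2 hg.symm]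
    have h2 : bypass i (h * g⁻¹) = bypass i h * g⁻¹ := by
      rw [bypass, h1, bypass, mul_assoc]
    have h3 := len_bypass_add_one (i := i) (σ := h * g⁻¹) (by rwa [h1])
    rw [bypass_of_fixed hg, len_mul_inv_comm g, len_mul_inv_comm g, ← h3, h2]
    simp [hg, hh]
  · have h1 : (g * h⁻¹) i = g i := by
      rw [Equiv.Perm.mul_apply, Equiv.Perm.inv_eq_iff_eq.2 hh.symm]
    have h2 : bypass i (g * h⁻¹) = bypass i g * h⁻¹ := by
      rw [bypass, h1, bypass, mul_assoc]
    have h3 := len_bypass_add_one (i := i) (σ := g * h⁻¹) (by rwa [h1])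
    rw [bypass_of_fixed hh, ← h3, h2]
    simp [hg, hh]
  · have e : bypass i g * (bypass i h)⁻¹
        = Equiv.swap i (g i) * (g * h⁻¹) * Equiv.swap i (h i) := by
      rw [bypass, bypass, mul_inv_rev, Equiv.swap_inv]
      simp only [mul_assoc]
    have h1 : len (bypass i g * (bypass i h)⁻¹) ≤ len (g * h⁻¹) + 1 := by
      rw [e]
      -- Invariance under `g * h⁻¹` gives `f (g i) = f (h i)`. Together with `f i = f (h i)`, both
      -- transpositions preserve `f`.
      refine len_le_of_forall i (h i) fun f hf hi z => ?_
      have h4 := hf (h i)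
      rw [Equiv.Perm.mul_apply, perm_inv_apply_apply] at h4
      rw [Equiv.Perm.mul_apply, Equiv.Perm.mul_apply, apply_swap_of_eq (hi.trans h4.symm), hf,
        apply_swap_of_eq hi]
    -- Two genuine transpositions preserve the sign, which rules out growth by exactly one.
    have h2 : Even (len (bypass i g * (bypass i h)⁻¹)) ↔ Even (len (g * h⁻¹)) := by
      apply even_iff_of_sign_eq
      rw [e, map_mul, map_mul, Equiv.Perm.sign_swap (Ne.symm hg),
        Equiv.Perm.sign_swap (Ne.symm hh)]
      simp
    simp only [hg, hh, if_true, add_zero]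
    by_contra hcon
    have h3 : len (bypass i g * (bypass i h)⁻¹) = len (g * h⁻¹) + 1 := by omega
    rw [h3, Nat.even_add_one] at h2
    exact iff_not_self h2.symm

end Length

/-! ### Tensions and threshold labels -/

section Labels

/-- The tensions of the triway cut problem; the regions are labelled `0, 1, 2`. -/
def tension (n : ℤ) (x y : Fin 3) : ℤ :=
  if x = y then 0 else if x = 2 ∨ y = 2 then n else 2 * (n - 1)

theorem tension_self (n : ℤ) (x : Fin 3) : tension n x x = 0 := by simp [tension]

theorem tension_triangle {n : ℤ} (hn : 2 ≤ n) (x y z : Fin 3) :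
    tension n x z ≤ tension n x y + tension n y z := by
  fin_cases x <;> fin_cases y <;> fin_cases z <;> simp [tension] <;> omega

/-- The label attached to the threshold `u` by the total mass `s` and the bias `d`. -/
def thresholdLabel (n s d u : ℤ) : Fin 3 :=
  if u < s - d then 1 else if 4 * (n * (n - 1)) - (s + d) ≤ u then 0 else 2

theorem sum_ite_lt_le (K x y c : ℤ) (hc : 0 ≤ c) :
    ∑ u ∈ Finset.Ico 0 K, (if (u < x ↔ u < y) then 0 else c) ≤ c * |x - y| := by
  have h1 : ∑ u ∈ Finset.Ico 0 K, (if (u < x ↔ u < y) then 0 else c)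
      = c * ((Finset.Ico 0 K).filter (fun u => ¬ (u < x ↔ u < y))).card := by
    rw [Finset.sum_ite, Finset.sum_const_zero, zero_add, Finset.sum_const, nsmul_eq_mul,
      mul_comm]
  rw [h1]
  refine mul_le_mul_of_nonneg_left ?_ hc
  have h2 : (Finset.Ico 0 K).filter (fun u => ¬ (u < x ↔ u < y))
      ⊆ Finset.Ico (min x y) (max x y) := by
    intro u hu
    rw [Finset.mem_filter] at hu
    rw [Finset.mem_Ico]
    omega
  have h3 := Finset.card_le_card h2
  rw [Int.card_Ico] at h3
  have h4 : ((max x y - min x y).toNat : ℤ) = |x - y| := by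
    rw [Int.toNat_of_nonneg (by omega), max_sub_min_eq_abs']
  rw [← h4]
  exact_mod_cast h3

/-- The bounds on the masses keep the two thresholds in order. A change between the labels 0 and 1
therefore crosses both of them and is charged 2n, more than its tension 2(n-1). -/
theorem tension_thresholdLabel_le {n : ℤ} (hn : 2 ≤ n) {s s' : ℤ} (d d' u : ℤ)
    (hs : s ≤ 2 * (n * (n - 1))) (hs' : s' ≤ 2 * (n * (n - 1))) :
    tension n (thresholdLabel n s d u) (thresholdLabel n s' d' u)
      ≤ (if (u < s - d ↔ u < s' - d') then 0 else n)
        + (if (u < 4 * (n * (n - 1)) - (s + d) ↔ u < 4 * (n * (n - 1)) - (s' + d'))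
            then 0 else n) := by
  unfold thresholdLabel
  generalize n * (n - 1) = K at *
  split_ifs <;> simp only [tension] <;> first | omega | simp

/-- With Δ the change from one pair to the other, |Δ(s-d)| + |Δ(s+d)| = 2 max(|Δs|, |Δd|) ≤ 4(n-1),
and each crossing is charged n. -/
theorem sum_tension_thresholdLabel_le {n : ℤ} (hn : 2 ≤ n) {s d s' d' : ℤ}
    (h : s ≤ 2 * (n * (n - 1))) (h' : s' ≤ 2 * (n * (n - 1)))
    (hs : |s - s'| ≤ 2 * (n - 1)) (hd : |d - d'| ≤ 2 * (n - 1)) :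
    ∑ u ∈ Finset.Ico 0 (4 * (n * (n - 1))),
      tension n (thresholdLabel n s d u) (thresholdLabel n s' d' u) ≤ 4 * (n * (n - 1)) := by
  refine (Finset.sum_le_sum fun u _ => tension_thresholdLabel_le hn d d' u h h').trans ?_
  rw [Finset.sum_add_distrib]
  refine (add_le_add (sum_ite_lt_le _ _ _ _ (by omega)) (sum_ite_lt_le _ _ _ _
    (by omega))).trans ?_
  rw [← mul_add]
  have : |s - d - (s' - d')| + |4 * (n * (n - 1)) - (s + d) - (4 * (n * (n - 1)) - (s' + d'))|
      ≤ 4 * (n - 1) := by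
    generalize 4 * (n * (n - 1)) = K
    rw [abs_le] at hs hd
    rcases abs_cases (s - d - (s' - d')) with h1 | h1 <;>
    rcases abs_cases (K - (s + d) - (K - (s' + d'))) with h2 | h2 <;> omega
  calc _ ≤ n * (4 * (n - 1)) := mul_le_mul_of_nonneg_left this (by omega)
    _ = _ := by ring

/-- At full mass the two thresholds coincide and the label 2 disappears, so a crossing costs only
2(n-1). This leaves room for a bias change of 2n instead of 2(n-1). -/
theorem sum_tension_thresholdLabel_le_of_full {n : ℤ} (hn : 2 ≤ n) {d d' : ℤ}
    (hd : |d - d'| ≤ 2 * n) :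
    ∑ u ∈ Finset.Ico 0 (4 * (n * (n - 1))),
      tension n (thresholdLabel n (2 * (n * (n - 1))) d u)
        (thresholdLabel n (2 * (n * (n - 1))) d' u) ≤ 4 * (n * (n - 1)) := by
  have key : ∀ u, tension n (thresholdLabel n (2 * (n * (n - 1))) d u)
        (thresholdLabel n (2 * (n * (n - 1))) d' u)
      ≤ if (u < 2 * (n * (n - 1)) - d ↔ u < 2 * (n * (n - 1)) - d') then 0
        else 2 * (n - 1) := by
    intro u
    unfold thresholdLabel
    generalize n * (n - 1) = K
    split_ifs <;> simp only [tension] <;> first | omega | simp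
  refine (Finset.sum_le_sum fun u _ => key u).trans ?_
  refine (sum_ite_lt_le _ _ _ _ (by omega)).trans ?_
  have : |2 * (n * (n - 1)) - d - (2 * (n * (n - 1)) - d')| ≤ 2 * n := by
    rw [← abs_neg]
    convert hd using 2
    ring
  calc _ ≤ 2 * (n - 1) * (2 * n) := mul_le_mul_of_nonneg_left this (by omega)
    _ = _ := by ring

end Labels

/-! ### Labels of permutations and their comparison with the Cayley distance -/

section Core

variable {α : Type*}

/-- Two permutations at the distances of `g_A X⁻¹` and `g_B X⁻¹` from each other and from the
identity, such that every point of a geodesic between them is at distance at least `n` from the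
identity. -/
structure IsReplicaPair [Fintype α] (n : ℕ) (P Q : Equiv.Perm α) : Prop where
  two_le : 2 ≤ n
  len_left : len P = n
  len_right : len Q = n
  len_mul : len (P * Q⁻¹) = 2 * (n - 1)
  le_len : ∀ g : Equiv.Perm α, len (g * P⁻¹) + len (g * Q⁻¹) = 2 * (n - 1) → n ≤ len g

theorem threshold_count_pos {n : ℕ} (hn' : 2 ≤ n) : 0 < 4 * ((n : ℤ) * (n - 1)) := by
  have hn : (2 : ℤ) ≤ n := by exact_mod_cast hn'
  have := mul_pos (by omega : (0 : ℤ) < n) (by omega : (0 : ℤ) < (n : ℤ) - 1)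
  omega

/-- The total mass of the labels `0` and `1` at `g`. -/
noncomputable def labelMass (n : ℕ) (g : Equiv.Perm α) : ℤ :=
  2 * ((n : ℤ) - 1) * min (n : ℤ) (len g : ℤ)

/-- The bias towards the label `0` at `g`. -/
noncomputable def labelBias (n : ℕ) (P Q g : Equiv.Perm α) : ℤ :=
  if len (g * P⁻¹) + len (g * Q⁻¹) = 2 * (n - 1) then
    n * ((len (g * Q⁻¹) : ℤ) - len (g * P⁻¹))
  else ((n : ℤ) - 1) * ((len (g * Q⁻¹) : ℤ) - len (g * P⁻¹))

theorem labelMass_le {n : ℕ} (hn : 1 ≤ n) (g : Equiv.Perm α) :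
    labelMass n g ≤ 2 * ((n : ℤ) * (n - 1)) := by
  have := mul_le_mul_of_nonneg_left (min_le_left (n : ℤ) (len g))
    (by omega : (0 : ℤ) ≤ 2 * ((n : ℤ) - 1))
  rw [labelMass]
  linarith

theorem labelBias_comm {n : ℕ} (P Q g : Equiv.Perm α) : labelBias n Q P g = - labelBias n P Q g := by
  rw [labelBias, labelBias, add_comm (len (g * Q⁻¹))]
  split_ifs <;> ring

/-- The label of `g` at the threshold `u`. -/
noncomputable def permLabel (n : ℕ) (P Q : Equiv.Perm α) (u : ℤ) (g : Equiv.Perm α) : Fin 3 :=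
  thresholdLabel n (labelMass n g) (labelBias n P Q g) u

variable [Fintype α]

/-- The triangle inequality bounds the change by one, and parity excludes no change. -/
theorem len_mul_inv_eq_succ_or [DecidableEq α] {g h : Equiv.Perm α} (hgh : len (g * h⁻¹) = 1)
    (k : Equiv.Perm α) :
    len (g * k⁻¹) = len (h * k⁻¹) + 1 ∨ len (h * k⁻¹) = len (g * k⁻¹) + 1 := by
  have h1 := len_triangle g h k
  have h2 := len_triangle h g k
  have h3 := even_len_triangle g h k
  rw [len_mul_inv_comm h g] at h2
  rw [hgh] at *
  rw [Nat.even_iff] at h3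
  omega

variable {n : ℕ} {P Q : Equiv.Perm α}

theorem IsReplicaPair.le_add (H : IsReplicaPair n P Q) (g : Equiv.Perm α) :
    2 * (n - 1) ≤ len (g * P⁻¹) + len (g * Q⁻¹) := by
  have := len_triangle P g Q
  rw [H.len_mul, len_mul_inv_comm P g] at this
  exact this

theorem IsReplicaPair.sum_tension_le_of_adjacent [DecidableEq α] (H : IsReplicaPair n P Q)
    {g h : Equiv.Perm α} (hgh : len (g * h⁻¹) = 1) :
    ∑ u ∈ Finset.Ico (0 : ℤ) (4 * ((n : ℤ) * (n - 1))),
      tension n (permLabel n P Q u g) (permLabel n P Q u h) ≤ 4 * ((n : ℤ) * (n - 1)) := by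
  have hn : (2 : ℤ) ≤ n := by exact_mod_cast H.two_le
  have hn' := H.two_le
  have hP := len_mul_inv_eq_succ_or hgh P
  have hQ := len_mul_inv_eq_succ_or hgh Q
  have h1 := len_mul_inv_eq_succ_or hgh 1
  have ag := H.le_add g
  have ah := H.le_add h
  have cg := H.le_len g
  have ch := H.le_len h
  have bg := len_triangle g P Q
  have bh := len_triangle h P Q
  have bg' := len_triangle g Q P
  have bh' := len_triangle h Q P
  rw [len_mul_inv_comm Q P] at bg' bh'
  rw [H.len_mul] at bg bh bg' bh'
  simp only [inv_one, mul_one] at h1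
  have hmass : |labelMass n g - labelMass n h| ≤ 2 * ((n : ℤ) - 1) := by
    unfold labelMass
    have : |min (n : ℤ) (len g) - min (n : ℤ) (len h)| ≤ 1 := by
      rw [abs_le]; omega
    rw [← mul_sub, abs_mul, abs_of_nonneg (by omega : (0 : ℤ) ≤ 2 * ((n : ℤ) - 1))]
    calc _ ≤ 2 * ((n : ℤ) - 1) * 1 := mul_le_mul_of_nonneg_left this (by omega)
      _ = _ := mul_one _
  unfold permLabel
  by_cases eg : len (g * P⁻¹) + len (g * Q⁻¹) = 2 * (n - 1) <;>
  by_cases eh : len (h * P⁻¹) + len (h * Q⁻¹) = 2 * (n - 1)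
  · have mg : labelMass n g = 2 * ((n : ℤ) * (n - 1)) := by
      rw [labelMass, min_eq_left (by exact_mod_cast cg eg)]; ring
    have mh : labelMass n h = 2 * ((n : ℤ) * (n - 1)) := by
      rw [labelMass, min_eq_left (by exact_mod_cast ch eh)]; ring
    rw [mg, mh]
    refine sum_tension_thresholdLabel_le_of_full hn ?_
    rw [labelBias, labelBias, if_pos eg, if_pos eh, ← mul_sub, abs_mul,
      abs_of_nonneg (by omega : (0 : ℤ) ≤ n), mul_comm]
    refine mul_le_mul_of_nonneg_right ?_ (by omega)
    rw [abs_le]; omega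
  · refine sum_tension_thresholdLabel_le hn (labelMass_le (by omega) g) (labelMass_le (by omega) h)
      hmass ?_
    rw [labelBias, labelBias, if_pos eg, if_neg eh]
    -- Leaving the geodesic raises both distances by one. Their difference is kept, so the change of
    -- slope from n to n-1 alters the bias by that difference only, which is at most 2(n-1) in
    -- absolute value.
    have e : (len (h * Q⁻¹) : ℤ) - len (h * P⁻¹) = (len (g * Q⁻¹) : ℤ) - len (g * P⁻¹) := by
      omega
    rw [e, ← sub_mul, sub_sub_cancel, one_mul, abs_le]
    omega
  · refine sum_tension_thresholdLabel_le hn (labelMass_le (by omega) g) (labelMass_le (by omega) h)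
      hmass ?_
    rw [labelBias, labelBias, if_neg eg, if_pos eh]
    have e : (len (h * Q⁻¹) : ℤ) - len (h * P⁻¹) = (len (g * Q⁻¹) : ℤ) - len (g * P⁻¹) := by
      omega
    rw [e, ← sub_mul, sub_sub_cancel_left, neg_mul, one_mul, abs_neg, abs_le]
    omega
  · refine sum_tension_thresholdLabel_le hn (labelMass_le (by omega) g) (labelMass_le (by omega) h)
      hmass ?_
    rw [labelBias, labelBias, if_neg eg, if_neg eh, ← mul_sub, abs_mul,
      abs_of_nonneg (by omega : (0 : ℤ) ≤ (n : ℤ) - 1), mul_comm]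
    refine mul_le_mul_of_nonneg_right ?_ (by omega)
    rw [abs_le]; omega

/-- A shortest path of transpositions joins `g` to `h`; the adjacent bound is added along it by the
triangle inequality for tensions. -/
theorem IsReplicaPair.sum_tension_le [DecidableEq α] (H : IsReplicaPair n P Q) (g h : Equiv.Perm α) :
    ∑ u ∈ Finset.Ico (0 : ℤ) (4 * ((n : ℤ) * (n - 1))),
      tension n (permLabel n P Q u g) (permLabel n P Q u h)
        ≤ 4 * ((n : ℤ) * (n - 1)) * len (g * h⁻¹) := by
  have hn : (2 : ℤ) ≤ n := by exact_mod_cast H.two_le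
  induction hk : len (g * h⁻¹) generalizing g with
  | zero =>
    rw [mul_inv_eq_one.1 (eq_one_of_len_eq_zero hk)]
    simp [tension_self]
  | succ k ih =>
    obtain ⟨i, hi⟩ := exists_moved_of_len_pos (σ := g * h⁻¹) (by omega)
    have h1 := len_bypass_add_one hi
    set g' := Equiv.swap i ((g * h⁻¹) i) * g with hg'
    have h2 : bypass i (g * h⁻¹) = g' * h⁻¹ := by rw [bypass, hg', mul_assoc]
    rw [h2] at h1
    have h3 : len (g * g'⁻¹) = 1 := by
      have h5 := len_triangle g g' h
      have h6 := len_swap_mul_le 1 i ((g * h⁻¹) i)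
      have h7 : g * g'⁻¹ = Equiv.swap i ((g * h⁻¹) i) * 1 := by
        rw [hg', mul_inv_rev, Equiv.swap_inv, mul_inv_cancel_left, mul_one]
      rw [← h7, len_one] at h6
      omega
    have h4 := ih g' (by omega)
    have h5 := H.sum_tension_le_of_adjacent h3
    refine (Finset.sum_le_sum fun u _ => tension_triangle hn _ (permLabel n P Q u g') _).trans ?_
    rw [Finset.sum_add_distrib]
    push_cast
    linarith

theorem IsReplicaPair.permLabel_left (H : IsReplicaPair n P Q) {u : ℤ} (hu : 0 ≤ u) :
    permLabel n P Q u P = 0 := by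
  have hn := H.two_le
  have h0 : len (P * P⁻¹) = 0 := by rw [mul_inv_cancel, len_one]
  have hb : labelBias n P Q P = 2 * ((n : ℤ) * (n - 1)) := by
    rw [labelBias, H.len_mul, h0, if_pos (by omega)]
    push_cast [Nat.cast_sub (by omega : 1 ≤ n)]
    ring
  have hm : labelMass n P = 2 * ((n : ℤ) * (n - 1)) := by
    rw [labelMass, H.len_left, min_self]; ring
  rw [permLabel, hb, hm, thresholdLabel, if_neg (by omega), if_pos (by omega)]

theorem IsReplicaPair.permLabel_right (H : IsReplicaPair n P Q) {u : ℤ}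
    (hu : u < 4 * ((n : ℤ) * (n - 1))) : permLabel n P Q u Q = 1 := by
  have hn := H.two_le
  have h0 : len (Q * Q⁻¹) = 0 := by rw [mul_inv_cancel, len_one]
  have hb : labelBias n P Q Q = - (2 * ((n : ℤ) * (n - 1))) := by
    rw [labelBias, len_mul_inv_comm Q P, H.len_mul, h0, if_pos (by omega)]
    push_cast [Nat.cast_sub (by omega : 1 ≤ n)]
    ring
  have hm : labelMass n Q = 2 * ((n : ℤ) * (n - 1)) := by
    rw [labelMass, H.len_right, min_self]; ring
  rw [permLabel, hb, hm, thresholdLabel, if_pos (by omega)]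

theorem IsReplicaPair.permLabel_one (H : IsReplicaPair n P Q) {u : ℤ} (hu : 0 ≤ u)
    (hu' : u < 4 * ((n : ℤ) * (n - 1))) : permLabel n P Q u 1 = 2 := by
  have hn := H.two_le
  have hb : labelBias n P Q 1 = 0 := by
    rw [labelBias, one_mul, one_mul, len_inv, len_inv, H.len_left, H.len_right,
      if_neg (by omega)]
    ring
  have hm : labelMass n (1 : Equiv.Perm α) = 0 := by
    rw [labelMass, len_one, Nat.cast_zero, min_eq_right (by omega)]; ring
  rw [permLabel, hb, hm, thresholdLabel, if_neg (by omega), if_neg (by omega)]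

/-- The distances to `Q` and `P` differ by at most 2(n-1). Off the geodesic the slope n-1 would
require a difference of 2n; on it, the difference equals the sum of the two distances. -/
theorem IsReplicaPair.len_eq_zero_of_bias (H : IsReplicaPair n P Q) {g : Equiv.Perm α}
    (h : 2 * ((n : ℤ) * (n - 1)) ≤ labelBias n P Q g) : len (g * P⁻¹) = 0 := by
  have hn := H.two_le
  have b := len_triangle g P Q
  rw [H.len_mul] at b
  rw [labelBias] at h
  split_ifs at h with hg
  · have : 2 * ((n : ℤ) - 1) ≤ (len (g * Q⁻¹) : ℤ) - len (g * P⁻¹) := by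
      refine le_of_mul_le_mul_left ?_ (by omega : (0 : ℤ) < n)
      linarith
    omega
  · have : 2 * (n : ℤ) ≤ (len (g * Q⁻¹) : ℤ) - len (g * P⁻¹) := by
      refine le_of_mul_le_mul_left ?_ (by omega : (0 : ℤ) < (n : ℤ) - 1)
      linarith
    omega

theorem IsReplicaPair.symm (H : IsReplicaPair n P Q) : IsReplicaPair n Q P where
  two_le := H.two_le
  len_left := H.len_right
  len_right := H.len_left
  len_mul := by rw [len_mul_inv_comm, H.len_mul]
  le_len g hg := H.le_len g (by rw [add_comm, hg])

theorem thresholdLabel_eq_zero {n s d u : ℤ} (h : thresholdLabel n s d u = 0) :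
    4 * (n * (n - 1)) - (s + d) ≤ u := by
  unfold thresholdLabel at h
  split_ifs at h with h1 h2
  · exact absurd h (by decide)
  · exact h2
  · exact absurd h (by decide)

theorem thresholdLabel_eq_one {n s d u : ℤ} (h : thresholdLabel n s d u = 1) : u < s - d := by
  unfold thresholdLabel at h
  split_ifs at h with h1 h2
  · exact h1
  · exact absurd h (by decide)
  · exact absurd h (by decide)

theorem thresholdLabel_eq_two {n s d u : ℤ} (h : thresholdLabel n s d u = 2) :
    s - d ≤ u ∧ u < 4 * (n * (n - 1)) - (s + d) := by
  unfold thresholdLabel at h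
  split_ifs at h with h1 h2
  · exact absurd h (by decide)
  · exact absurd h (by decide)
  · omega

/-- The label 0 at the lowest threshold means s+d ≥ K; since s ≤ K/2, the bias is at least K/2. -/
theorem IsReplicaPair.eq_left [DecidableEq α] (H : IsReplicaPair n P Q) {g : Equiv.Perm α}
    (h : permLabel n P Q 0 g = 0) : g = P := by
  have h1 := thresholdLabel_eq_zero h
  have hn : 1 ≤ n := le_trans (by norm_num) H.two_le
  have h2 := labelMass_le hn g
  exact mul_inv_eq_one.1 (eq_one_of_len_eq_zero (H.len_eq_zero_of_bias (by omega)))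

theorem IsReplicaPair.eq_right [DecidableEq α] (H : IsReplicaPair n P Q) {g : Equiv.Perm α}
    (h : permLabel n P Q (4 * ((n : ℤ) * (n - 1)) - 1) g = 1) : g = Q := by
  have h1 := thresholdLabel_eq_one h
  have hn : 1 ≤ n := le_trans (by norm_num) H.two_le
  have h2 := labelMass_le hn g
  refine mul_inv_eq_one.1 (eq_one_of_len_eq_zero (H.symm.len_eq_zero_of_bias ?_))
  rw [labelBias_comm P Q]
  omega

/-- The two extreme thresholds give s-d ≤ 0 and s+d ≤ 0, so the mass, and with it the length,
vanishes. -/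
theorem IsReplicaPair.eq_one [DecidableEq α] (H : IsReplicaPair n P Q) {g : Equiv.Perm α}
    (h0 : permLabel n P Q 0 g = 2)
    (h : permLabel n P Q (4 * ((n : ℤ) * (n - 1)) - 1) g = 2) : g = 1 := by
  have hn := H.two_le
  have h1 := thresholdLabel_eq_two h0
  have h2 := thresholdLabel_eq_two h
  have h3 : labelMass n g ≤ 0 := by omega
  rw [labelMass] at h3
  have h4 : min (n : ℤ) (len g) ≤ 0 := by
    by_contra hcon
    have := mul_pos (by omega : (0 : ℤ) < 2 * ((n : ℤ) - 1)) (not_le.1 hcon)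
    omega
  exact eq_one_of_len_eq_zero (by omega)

end Core
-- Successive removal of points from the cycles
section Bypass

variable {α : Type*} [DecidableEq α]

/-- Remove the points of a list, one after the other, from the cycles of a permutation. -/
def bypassList : List α → Equiv.Perm α → Equiv.Perm α
  | [], g => g
  | i :: L, g => bypassList L (bypass i g)

/-- The `j`-th point of the list is moved when its turn comes to be removed. -/
def MovedAt (L : List α) (g : Equiv.Perm α) (j : Fin L.length) : Prop :=
  bypassList (L.take j) g L[j] ≠ L[j]

theorem movedAt_cons_zero (i : α) (L : List α) (g : Equiv.Perm α) :
    MovedAt (i :: L) g 0 ↔ g i ≠ i := Iff.rfl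

theorem movedAt_cons_succ (i : α) (L : List α) (g : Equiv.Perm α) (j : Fin L.length) :
    MovedAt (i :: L) g j.succ ↔ MovedAt L (bypass i g) j := Iff.rfl

theorem bypassList_apply_of_fixed {L : List α} {g : Equiv.Perm α} {x : α} (h : g x = x) :
    bypassList L g x = x := by
  induction L generalizing g with
  | nil => exact h
  | cons i L ih => exact ih (bypass_apply_of_fixed h)

theorem bypassList_apply_of_mem {L : List α} {g : Equiv.Perm α} {x : α} (h : x ∈ L) :
    bypassList L g x = x := by
  induction L generalizing g with
  | nil => exact absurd h List.not_mem_nil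
  | cons i L ih =>
    rcases List.mem_cons.1 h with rfl | h
    · exact bypassList_apply_of_fixed (L := L) (g := bypass x g) (bypass_apply_self x g)
    · exact ih h

theorem apply_bypassList {β : Type*} {φ : α → β} {L : List α} {g : Equiv.Perm α}
    (h : ∀ x, φ (g x) = φ x) (x : α) : φ (bypassList L g x) = φ x := by
  induction L generalizing g with
  | nil => exact h x
  | cons i L ih => exact ih (apply_bypass h i)

theorem bypassList_eq_self {L : List α} {g : Equiv.Perm α} (h : ∀ j, ¬ MovedAt L g j) :
    bypassList L g = g := by
  induction L generalizing g with
  | nil => rfl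
  | cons i L ih =>
    have h0 : g i = i := not_not.1 (h (0 : Fin (L.length + 1)))
    rw [bypassList, bypass_of_fixed h0]
    refine ih fun j => ?_
    have := h j.succ
    rwa [movedAt_cons_succ, bypass_of_fixed h0] at this

theorem not_movedAt {L : List α} {g : Equiv.Perm α} (h : ∀ x ∈ L, g x = x)
    (j : Fin L.length) : ¬ MovedAt L g j :=
  not_not.2 (bypassList_apply_of_fixed (h _ (List.getElem_mem _)))

variable [Fintype α]

open Classical in
theorem len_bypassList_mul_inv_add_le (L : List α) (g h : Equiv.Perm α) :
    len (bypassList L g * (bypassList L h)⁻¹)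
      + ∑ j, (if (MovedAt L g j ↔ MovedAt L h j) then 0 else 1) ≤ len (g * h⁻¹) := by
  induction L generalizing g h with
  | nil => simp [bypassList]
  | cons i L ih =>
    have h1 := len_bypass_mul_inv_add_le i g h
    have h2 := ih (bypass i g) (bypass i h)
    have h3 := Fin.sum_univ_succ (n := L.length) (fun j : Fin (L.length + 1) =>
      if (MovedAt (i :: L) g j ↔ MovedAt (i :: L) h j) then 0 else 1)
    simp only [movedAt_cons_zero, movedAt_cons_succ, not_iff_not, ne_eq] at h3
    change len (bypassList L (bypass i g) * (bypassList L (bypass i h))⁻¹)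
      + ∑ j : Fin (L.length + 1), _ ≤ _
    rw [h3]
    omega

open Classical in
theorem len_le_sum_movedAt_add (L : List α) (g : Equiv.Perm α) :
    len g ≤ ∑ j, (if MovedAt L g j then 1 else 0) + len (bypassList L g) := by
  induction L generalizing g with
  | nil => simp [bypassList]
  | cons i L ih =>
    have h2 := ih (bypass i g)
    have h3 := Fin.sum_univ_succ (n := L.length) (fun j : Fin (L.length + 1) =>
      if MovedAt (i :: L) g j then 1 else 0)
    simp only [movedAt_cons_zero, movedAt_cons_succ] at h3
    change _ ≤ ∑ j : Fin (L.length + 1), _ + len (bypassList L (bypass i g))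
    rw [h3]
    by_cases h0 : g i = i
    · rw [bypass_of_fixed h0] at *
      omega
    · have := len_bypass_add_one h0
      rw [if_pos h0]
      omega

/-- A removal lowers the length by one or not at all; to reach length 0, none may be idle. -/
theorem movedAt_of_length_le {L : List α} {g : Equiv.Perm α} (h : bypassList L g = 1)
    (hL : L.length ≤ len g) (j : Fin L.length) : MovedAt L g j := by
  classical
  by_contra hj
  have h1 := len_le_sum_movedAt_add L g
  rw [h, len_one, add_zero] at h1
  have h2 : ∑ j, (if MovedAt L g j then 1 else 0) < ∑ _j : Fin L.length, 1 :=
    Finset.sum_lt_sum (fun k _ => by split_ifs <;> simp) ⟨j, Finset.mem_univ _, by simp [hj]⟩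
  simp only [Finset.sum_const, Finset.card_univ, Fintype.card_fin, smul_eq_mul, mul_one] at h2
  omega

end Bypass

/-! ### Explicit action of the cycles on one row -/

section Columns

theorem sameCycle_of_step {N : ℕ} {σ : Equiv.Perm (Fin N)} {a b : ℕ}
    (step : ∀ x : Fin N, a ≤ x.val → x.val + 1 < b → (σ x).val = x.val + 1)
    (y x : Fin N) (hy : y.val = a) (hx : a ≤ x.val) (hxb : x.val < b) : σ.SameCycle y x := by
  obtain ⟨k, hk⟩ := Nat.exists_eq_add_of_le hx
  induction k generalizing x with
  | zero => rw [show y = x from Fin.ext (by omega)]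
  | succ k ih =>
    have hlt := x.isLt
    have h1 := ih ⟨a + k, by omega⟩ (by simp) (by simp; omega) (by simp)
    have h2 : σ ⟨a + k, by omega⟩ = x :=
      Fin.ext ((step _ (by simp) (by simp; omega)).trans (by simp; omega))
    rw [← h2, Equiv.Perm.sameCycle_apply_right]
    exact h1

theorem val_finRotate {N : ℕ} (x : Fin N) :
    (finRotate N x).val = if x.val + 1 = N then 0 else x.val + 1 := by
  cases N with
  | zero => exact x.elim0
  | succ N =>
    rw [coe_finRotate]
    simp only [Fin.ext_iff, Fin.val_last, add_left_inj]

theorem sameCycle_finRotate {N : ℕ} (x y : Fin N) : (finRotate N).SameCycle x y := by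
  have key : ∀ z : Fin N, (finRotate N).SameCycle ⟨0, z.pos⟩ z := fun z =>
    sameCycle_of_step (a := 0) (b := N) (fun w _ hw => by rw [val_finRotate, if_neg (by omega)])
      _ z rfl (Nat.zero_le _) z.isLt
  exact (key x).symm.trans (key y)

theorem map_val_filter_finRange (m : ℕ) (p : ℕ → Bool) :
    ((List.finRange m).filter (fun l => p l.val)).map Fin.val = (List.range m).filter p := by
  rw [← List.map_coe_finRange_eq_range, List.filter_map]
  rfl

theorem filter_lt_range (h k : ℕ) :
    (List.range (h + k)).filter (fun l => decide (l < h)) = List.range h := by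
  rw [List.range_add, List.filter_append, List.filter_eq_self.2, List.filter_eq_nil_iff.2,
    List.append_nil]
  · intro a ha
    obtain ⟨b, -, rfl⟩ := List.mem_map.1 ha
    simp
  · intro a ha
    simpa using ha

theorem filter_le_range (h k : ℕ) :
    (List.range (h + k)).filter (fun l => decide (h ≤ l)) = (List.range k).map (h + ·) := by
  rw [List.range_add, List.filter_append, List.filter_eq_nil_iff.2, List.filter_eq_self.2,
    List.nil_append]
  · intro a ha
    obtain ⟨b, -, rfl⟩ := List.mem_map.1 ha
    simp
  · intro a ha
    simpa using ha

theorem val_formPerm_apply {m a k : ℕ} {L : List (Fin m)}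
    (hL : L.map Fin.val = (List.range k).map (a + ·)) (x : Fin m) :
    (L.formPerm x).val = if a ≤ x.val ∧ x.val < a + k then
      (if x.val + 1 = a + k then a else x.val + 1) else x.val := by
  have hlen : L.length = k := by simpa using congrArg List.length hL
  have hnd : L.Nodup := by
    refine List.Nodup.of_map Fin.val ?_
    rw [hL]
    exact List.nodup_range.map (fun _ _ h => Nat.add_left_cancel h)
  have hget : ∀ i (hi : i < L.length), (L[i]).val = a + i := by
    intro i hi
    have h1 : (L.map Fin.val)[i]'(by simpa using hi) = (L[i]).val := List.getElem_map ..
    rw [← h1]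
    simp [hL]
  split_ifs with hx hx'
  · obtain ⟨i, hi⟩ := Nat.exists_eq_add_of_le hx.1
    have hi' : i < L.length := by omega
    have : x = L[i] := Fin.ext (by rw [hget, hi])
    rw [this, List.formPerm_apply_getElem L hnd, hget, show i + 1 = L.length by omega,
      Nat.mod_self, add_zero]
  · obtain ⟨i, hi⟩ := Nat.exists_eq_add_of_le hx.1
    have hi' : i < L.length := by omega
    have : x = L[i] := Fin.ext (by rw [hget, hi])
    rw [this, List.formPerm_apply_getElem L hnd, hget, hget, Nat.mod_eq_of_lt (by omega),
      add_assoc]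
  · rw [List.formPerm_apply_of_notMem]
    intro hmem
    obtain ⟨i, hi, rfl⟩ := List.getElem_of_mem hmem
    rw [hget] at hx
    omega

/-- The action of `X` on a row. -/
def rowCycle (m : ℕ) : Equiv.Perm (Fin m) := upperHalfCycle m * lowerHalfCycle m

theorem val_rowCycle {m h : ℕ} (hm : m = h + h) (x : Fin m) :
    (rowCycle m x).val
      = if x.val + 1 = h then 0 else if x.val + 1 = m then h else x.val + 1 := by
  subst hm
  have e : (h + h) / 2 = h := by omega
  have hu := val_formPerm_apply (a := 0) (k := h)
    (L := (List.finRange (h + h)).filter (fun l => l.val < h))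
    ((map_val_filter_finRange (h + h) (fun l => decide (l < h))).trans
      ((filter_lt_range h h).trans (by simp)))
  have hl := val_formPerm_apply (a := h) (k := h)
    (L := (List.finRange (h + h)).filter (fun l => h ≤ l.val))
    ((map_val_filter_finRange (h + h) (fun l => decide (h ≤ l))).trans (filter_le_range h h))
  rw [rowCycle, Equiv.Perm.mul_apply, upperHalfCycle, lowerHalfCycle, e, hu, hl]
  have := x.isLt
  split_ifs <;> omega

end Columns

/-! ### The permutations g_A X⁻¹ and g_B X⁻¹ -/

section Replicas

variable {n m : ℕ}

theorem gX_apply (p : Fin n × Fin m) : gX n m p = (p.1, rowCycle m p.2) := rfl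

theorem gB_apply (p : Fin n × Fin m) : gB n m p = (p.1, finRotate m p.2) := rfl

theorem lowerShift_apply (p : Fin n × Fin m) :
    lowerShift n m p = (if m / 2 ≤ p.2.val then finRotate n p.1 else p.1, p.2) := rfl

theorem lowerShift_inv_apply (p : Fin n × Fin m) :
    (lowerShift n m)⁻¹ p = (if m / 2 ≤ p.2.val then (finRotate n).symm p.1 else p.1, p.2) := rfl

/-- X acts alike on all rows and preserves each half of the columns. Hence `relA` is the conjugate
of `relB` by `lowerShift`. -/
theorem commute_lowerShift_gX (hm : Even m) : Commute (lowerShift n m) (gX n m) := by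
  obtain ⟨h, hm⟩ := hm
  refine Equiv.ext fun p => ?_
  rw [Equiv.Perm.mul_apply, Equiv.Perm.mul_apply, gX_apply, gX_apply, lowerShift_apply,
    lowerShift_apply]
  have h1 := val_rowCycle hm p.2
  have h2 : m / 2 ≤ (rowCycle m p.2).val ↔ m / 2 ≤ p.2.val := by
    have := p.2.isLt
    rw [h1]
    split_ifs <;> omega
  simp only [h2]

/-- The permutation `g_B X⁻¹`. -/
def relB (n m : ℕ) : ReplicaPerm n m := gB n m * (gX n m)⁻¹

/-- The permutation `g_A X⁻¹`. -/
def relA (n m : ℕ) : ReplicaPerm n m := gA n m * (gX n m)⁻¹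

/-- One transposition merges the two half-row cycles into the full rotation. -/
theorem finRotate_eq_swap_rowCycle {h : ℕ} (hm : m = h + h) (hh : 0 < h) (x : Fin m) :
    finRotate m x = Equiv.swap ⟨0, by omega⟩ ⟨h, by omega⟩ (rowCycle m x) := by
  have h1 := val_rowCycle hm x
  have h2 := x.isLt
  have h3 := val_finRotate x
  rw [Equiv.swap_apply_def]
  split_ifs at h1 h3 ⊢ with h4 h5 h6 h7 <;> simp only [Fin.ext_iff] at * <;> omega

theorem relB_apply {h : ℕ} (hm : m = h + h) (hh : 0 < h) (p : Fin n × Fin m) :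
    relB n m p = (p.1, Equiv.swap ⟨0, by omega⟩ ⟨h, by omega⟩ p.2) := by
  obtain ⟨q, rfl⟩ := (gX n m).surjective p
  rw [relB, Equiv.Perm.mul_apply, perm_inv_apply_apply, gB_apply, gX_apply,
    finRotate_eq_swap_rowCycle hm hh]

theorem relA_apply {h : ℕ} (hm : m = h + h) (hh : 0 < h) (p : Fin n × Fin m) :
    relA n m p = if p.2.val = 0 then ((finRotate n).symm p.1, ⟨h, by omega⟩)
      else if p.2.val = h then (finRotate n p.1, ⟨0, by omega⟩) else p := by
  have e : relA n m = (lowerShift n m)⁻¹ * relB n m * lowerShift n m := by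
    have := ((commute_lowerShift_gX (n := n) (m := m) ⟨h, hm⟩).inv_right).eq
    rw [relA, gA, relB, mul_assoc, this]
    simp only [mul_assoc]
  obtain ⟨k, l⟩ := p
  rw [e, Equiv.Perm.mul_apply, Equiv.Perm.mul_apply, lowerShift_apply, relB_apply hm hh,
    lowerShift_inv_apply, Equiv.swap_apply_def]
  have e2 : m / 2 = h := by omega
  simp only [e2, Fin.ext_iff]
  by_cases h0 : l.val = 0
  · simp [h0, hh.ne']
  · by_cases h1 : l.val = h
    · simp [h1, hh.ne']
    · simp only [h0, h1, if_false]
      split_ifs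
      · rw [Equiv.symm_apply_apply]
      · rfl

end Replicas
-- Distances among the column matchings, and removal of the bulk
section ReplicaPair

variable {n m h : ℕ}

/-- Over the columns `0` and `h`, an involution that exchanges the two columns and fixes every
other point. -/
structure IsColumnMatching (h : ℕ) (M : ReplicaPerm n m) : Prop where
  involutive : ∀ p, M (M p) = p
  col_zero : ∀ p, p.2.val = 0 → (M p).2.val = h
  col_h : ∀ p, p.2.val = h → (M p).2.val = 0
  fixed : ∀ p : Fin n × Fin m, p.2.val ≠ 0 → p.2.val ≠ h → M p = p

theorem card_column (hh : h < m) : Nat.card {p : Fin n × Fin m // p.2.val = h} = n := by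
  refine (Nat.card_congr (β := Fin n) ⟨fun p => p.1.1, fun k => ⟨(k, ⟨h, hh⟩), rfl⟩,
    fun p => Subtype.ext (Prod.ext rfl (Fin.ext p.2.symm)), fun k => rfl⟩).trans (by simp)

theorem IsColumnMatching.len_eq {M : ReplicaPerm n m} (H : IsColumnMatching h M) (h0 : 0 < h)
    (hh : h < m) : len M = n := by
  have hM : ∀ p, M.SameCycle p (M p) := fun p => by
    rw [Equiv.Perm.sameCycle_apply_right]
  rw [len_eq_card_of_representative (fun p => if p.2.val = h then M p else p)]
  · refine Eq.trans ?_ (card_column (n := n) hh)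
    refine Nat.card_congr (Equiv.subtypeEquivRight fun p => ?_)
    by_cases hp : p.2.val = h
    · simp only [hp, if_true, iff_true]
      intro e
      have := H.col_h p hp
      rw [e] at this
      omega
    · simp [hp]
  · intro p
    split_ifs
    · exact hM p
    · exact Equiv.Perm.SameCycle.refl _ _
  · intro p
    by_cases hp : p.2.val = h
    · rw [if_pos hp, H.col_h p hp, if_neg h0.ne]
    · by_cases hp0 : p.2.val = 0
      · rw [if_pos (H.col_zero p hp0), H.involutive, if_neg hp]
      · rw [if_neg hp, H.fixed p hp0 hp, if_neg hp]

theorem isColumnMatching_relB (hm : m = h + h) (hh : 0 < h) :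
    IsColumnMatching h (relB n m) where
  involutive p := by simp [relB_apply hm hh]
  col_zero p hp := by
    have : p.2 = ⟨0, by omega⟩ := Fin.ext hp
    simp [relB_apply hm hh, this]
  col_h p hp := by
    have : p.2 = ⟨h, by omega⟩ := Fin.ext hp
    simp [relB_apply hm hh, this]
  fixed p h1 h2 := by
    rw [relB_apply hm hh, Equiv.swap_apply_of_ne_of_ne]
    · exact fun e => h1 (congrArg Fin.val e)
    · exact fun e => h2 (congrArg Fin.val e)

theorem isColumnMatching_relA (hm : m = h + h) (hh : 0 < h) :
    IsColumnMatching h (relA n m) where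
  involutive p := by
    have hm0 : 0 < m := by omega
    have hmh : h < m := by omega
    obtain ⟨k, l⟩ := p
    by_cases h0 : l.val = 0
    · have : l = ⟨0, by omega⟩ := Fin.ext h0
      subst this
      simp only [relA_apply hm hh, if_true, hh.ne', if_false, Equiv.apply_symm_apply]
    · by_cases h1 : l.val = h
      · have : l = ⟨h, by omega⟩ := Fin.ext h1
        subst this
        simp only [relA_apply hm hh, if_true, hh.ne', if_false, Equiv.symm_apply_apply]
      · simp only [relA_apply hm hh, h0, h1, if_false]
  col_zero p hp := by simp [relA_apply hm hh, hp]
  col_h p hp := by simp [relA_apply hm hh, hp, hh.ne']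
  fixed p h1 h2 := by simp [relA_apply hm hh, h1, h2]

theorem relA_mul_inv_relB_apply (hm : m = h + h) (hh : 0 < h) (p : Fin n × Fin m) :
    (relA n m * (relB n m)⁻¹) p = (if p.2.val = 0 then finRotate n p.1
      else if p.2.val = h then (finRotate n).symm p.1 else p.1, p.2) := by
  have e : (relB n m)⁻¹ p = relB n m p := by
    rw [Equiv.Perm.inv_eq_iff_eq, (isColumnMatching_relB hm hh).involutive]
  have hm0 : 0 < m := by omega
  have hmh : h < m := by omega
  obtain ⟨k, l⟩ := p
  rw [Equiv.Perm.mul_apply, e]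
  by_cases h0 : l.val = 0
  · have : l = ⟨0, by omega⟩ := Fin.ext h0
    subst this
    simp [relA_apply hm hh, relB_apply hm hh, hh.ne']
  · by_cases h1 : l.val = h
    · have : l = ⟨h, by omega⟩ := Fin.ext h1
      subst this
      simp [relA_apply hm hh, relB_apply hm hh, hh.ne']
    · rw [(isColumnMatching_relB hm hh).fixed _ h0 h1,
        (isColumnMatching_relA hm hh).fixed _ h0 h1]
      simp [h0, h1]

theorem card_two_columns (hn : 0 < n) (h0 : 0 < h) (hh : h < m) :
    Nat.card {p : Fin n × Fin m // p.1.val ≠ 0 ∧ (p.2.val = 0 ∨ p.2.val = h)}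
      = 2 * (n - 1) := by
  have e : {p : Fin n × Fin m // p.1.val ≠ 0 ∧ (p.2.val = 0 ∨ p.2.val = h)}
      ≃ Bool × Fin (n - 1) :=
    { toFun := fun p => (decide (p.1.2.val = 0), ⟨p.1.1.val - 1, by have := p.1.1.isLt; omega⟩)
      invFun := fun b => ⟨(⟨b.2.val + 1, by omega⟩, ⟨if b.1 then 0 else h, by split_ifs <;> omega⟩),
        by simp, by cases b.1 <;> simp⟩
      left_inv := fun ⟨p, h1, h2⟩ => by
        refine Subtype.ext (Prod.ext (Fin.ext ?_) (Fin.ext ?_))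
        · simp; omega
        · rcases h2 with h2 | h2 <;> simp [h2, h0.ne']
      right_inv := fun ⟨b, k⟩ => by
        cases b <;> simp [h0.ne'] }
  rw [Nat.card_congr e]
  simp

/-- Column 0 is rotated forwards and column h backwards: two cycles of length n, each contributing
n-1. -/
theorem len_relA_mul_inv_relB (hm : m = h + h) (hh : 0 < h) (hn : 0 < n) :
    len (relA n m * (relB n m)⁻¹) = 2 * (n - 1) := by
  rw [← card_two_columns (m := m) hn hh (by omega), len_eq_card_of_representative
    (fun p => if p.2.val = 0 ∨ p.2.val = h then (⟨0, hn⟩, p.2) else p)]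
  · refine Nat.card_congr (Equiv.subtypeEquivRight fun p => ?_)
    by_cases hp : p.2.val = 0 ∨ p.2.val = h
    · rw [if_pos hp]
      simp only [ne_eq, Prod.ext_iff, Fin.ext_iff, hp, and_true]
      omega
    · simp [hp]
  · rintro ⟨k, l⟩
    dsimp only
    by_cases h0 : l.val = 0
    · rw [if_pos (Or.inl h0)]
      refine sameCycle_of_semiconj (ρ := finRotate n) (fun k => (k, l)) (fun x => ?_)
        (sameCycle_finRotate k _)
      rw [relA_mul_inv_relB_apply hm hh]
      simp [h0]
    · by_cases h1 : l.val = h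
      · rw [if_pos (Or.inr h1)]
        refine sameCycle_of_semiconj (ρ := (finRotate n)⁻¹) (fun k => (k, l)) (fun x => ?_)
          (Equiv.Perm.sameCycle_inv.2 (sameCycle_finRotate k _))
        rw [relA_mul_inv_relB_apply hm hh]
        simp only [h1, hh.ne', if_true, if_false]
        rfl
      · rw [if_neg (by tauto)]
  · rintro ⟨k, l⟩
    rw [relA_mul_inv_relB_apply hm hh]
    by_cases h0 : l.val = 0
    · simp [h0]
    · by_cases h1 : l.val = h
      · simp [h1]
      · simp [h0, h1]

theorem isReplicaPair (hn : 2 ≤ n) (hm : m = h + h) (hh : 0 < h) :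
    IsReplicaPair n (relA n m) (relB n m) where
  two_le := hn
  len_left := (isColumnMatching_relA hm hh).len_eq hh (by omega)
  len_right := (isColumnMatching_relB hm hh).len_eq hh (by omega)
  len_mul := len_relA_mul_inv_relB hm hh (by omega)
  le_len g hg := by
    refine (card_column (n := n) (m := m) (h := h) (by omega)).symm.le.trans ?_
    -- It suffices that `g` sends column h off itself. On the geodesic, the indicator of column 0 is
    -- invariant under `relA * g⁻¹`, which maps `g p` to `relA p`, a point of column 0; so `g p` is
    -- in column 0.
    refine card_le_len _ fun p hp => ⟨g p, ?_, by rw [Equiv.Perm.sameCycle_apply_left]⟩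
    have h1 : invariants (relA n m * (relB n m)⁻¹) ≤ invariants (relA n m * g⁻¹) := by
      have e : relA n m * (relB n m)⁻¹ = (relA n m * g⁻¹) * (g * (relB n m)⁻¹) := by group
      rw [e]
      refine invariants_mul_le_left ?_
      rw [← e, len_relA_mul_inv_relB hm hh (by omega), ← hg, len_mul_inv_comm g (relA n m)]
    have h2 : (fun q : Fin n × Fin m => if q.2.val = 0 then (1 : ℚ) else 0)
        ∈ invariants (relA n m * (relB n m)⁻¹) := fun q => by
      rw [relA_mul_inv_relB_apply hm hh]
    have h3 := h1 h2 (g p)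
    rw [Equiv.Perm.mul_apply, perm_inv_apply_apply, (isColumnMatching_relA hm hh).col_h p hp,
      if_pos rfl] at h3
    intro h4
    rw [if_neg (by omega)] at h3
    exact one_ne_zero h3

/-- The replicas outside the columns `0` and `h`. -/
noncomputable def bulkReplicas (n m h : ℕ) : List (Fin n × Fin m) :=
  (Finset.univ.filter fun p : Fin n × Fin m => p.2.val ≠ 0 ∧ p.2.val ≠ h).toList

theorem mem_bulkReplicas {p : Fin n × Fin m} :
    p ∈ bulkReplicas n m h ↔ p.2.val ≠ 0 ∧ p.2.val ≠ h := by
  simp [bulkReplicas]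

theorem length_bulkReplicas : (bulkReplicas n m h).length
    = Nat.card {p : Fin n × Fin m // p.2.val ≠ 0 ∧ p.2.val ≠ h} := by
  rw [bulkReplicas, Finset.length_toList, Nat.card_eq_fintype_card, Fintype.card_subtype]

theorem le_val_rowCycle_iff (hm : m = h + h) (x : Fin m) :
    h ≤ (rowCycle m x).val ↔ h ≤ x.val := by
  have := x.isLt
  rw [val_rowCycle hm]
  split_ifs <;> omega

/-- Each half-row is one cycle of X and contains exactly one replica outside the bulk, which serves
as its representative. -/
theorem len_gX (hm : m = h + h) (hh : 0 < h) :
    len (gX n m) = (bulkReplicas n m h).length := by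
  rw [length_bulkReplicas, len_eq_card_of_representative
    (fun p => (p.1, if h ≤ p.2.val then ⟨h, by omega⟩ else ⟨0, by omega⟩))]
  · refine Nat.card_congr (Equiv.subtypeEquivRight fun p => ?_)
    simp only [ne_eq, Prod.ext_iff, Fin.ext_iff, true_and]
    split_ifs <;> simp only <;> omega
  · rintro ⟨k, l⟩
    refine sameCycle_of_semiconj (ρ := rowCycle m) (fun l => (k, l)) (fun _ => rfl) ?_
    have := l.isLt
    dsimp only
    split_ifs with hl
    · exact (sameCycle_of_step (a := h) (b := m) (fun x h1 h2 => by
        rw [val_rowCycle hm, if_neg (by omega), if_neg (by omega)]) _ l rfl hl l.isLt).symm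
    · exact (sameCycle_of_step (a := 0) (b := h) (fun x h1 h2 => by
        rw [val_rowCycle hm, if_neg (by omega), if_neg (by omega)]) _ l rfl (by omega)
          (by omega)).symm
  · intro p
    rw [gX_apply]
    simp only [le_val_rowCycle_iff hm]

/-- After the removal every half-row is still preserved and its bulk points are fixed, so its one
remaining point is fixed as well. -/
theorem bypassList_gX_inv (hm : m = h + h) :
    bypassList (bulkReplicas n m h) (gX n m)⁻¹ = 1 := by
  have hinv : ∀ p, (fun p : Fin n × Fin m => (p.1, decide (h ≤ p.2.val))) ((gX n m)⁻¹ p)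
      = (fun p : Fin n × Fin m => (p.1, decide (h ≤ p.2.val))) p := by
    intro p
    obtain ⟨q, rfl⟩ := (gX n m).surjective p
    rw [perm_inv_apply_apply, gX_apply]
    simp only [le_val_rowCycle_iff hm]
  have hfix : ∀ p : Fin n × Fin m, p.2.val ≠ 0 ∧ p.2.val ≠ h →
      bypassList (bulkReplicas n m h) (gX n m)⁻¹ p = p := fun p hp =>
    bypassList_apply_of_mem (mem_bulkReplicas.2 hp)
  refine Equiv.ext fun p => ?_
  rw [Equiv.Perm.one_apply]
  by_cases hp : p.2.val ≠ 0 ∧ p.2.val ≠ h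
  · exact hfix p hp
  · have h1 := apply_bypassList (φ := fun p : Fin n × Fin m => (p.1, decide (h ≤ p.2.val)))
      (L := bulkReplicas n m h) hinv p
    set q := bypassList (bulkReplicas n m h) (gX n m)⁻¹ p with hq
    by_cases hq' : q.2.val ≠ 0 ∧ q.2.val ≠ h
    · exact (bypassList (bulkReplicas n m h) (gX n m)⁻¹).injective (hfix q hq')
    · have h2 := Prod.ext_iff.1 h1
      simp only [decide_eq_decide] at h2
      exact Prod.ext h2.1 (Fin.ext (by omega))

theorem movedAt_gX_inv (hm : m = h + h) (hh : 0 < h) (j : Fin (bulkReplicas n m h).length) :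
    MovedAt (bulkReplicas n m h) (gX n m)⁻¹ j :=
  movedAt_of_length_le (bypassList_gX_inv hm) (by rw [len_inv, len_gX hm hh]) j

theorem IsColumnMatching.not_movedAt {M : ReplicaPerm n m} (H : IsColumnMatching h M)
    (j : Fin (bulkReplicas n m h).length) : ¬ MovedAt (bulkReplicas n m h) M j :=
  ReflectedEntropy.not_movedAt (fun p hp => by
    rw [mem_bulkReplicas] at hp
    exact H.fixed p hp.1 hp.2) j

theorem IsColumnMatching.bypassList_eq {M : ReplicaPerm n m} (H : IsColumnMatching h M) :
    bypassList (bulkReplicas n m h) M = M :=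
  bypassList_eq_self H.not_movedAt

end ReplicaPair
-- Energies, cut weights and areas as sums over edges
section EdgeSums

theorem eq_zero_or_one_or_two (a : Fin 3) : a = 0 ∨ a = 1 ∨ a = 2 := by
  fin_cases a <;> simp

theorem mk_out {V : Type*} (e : Sym2 V) : s((Quot.out e).1, (Quot.out e).2) = e := Quot.out_eq e

variable {V : Type*} [Finite V] (G : SimpleGraph V) (w : Sym2 V → ℝ)

/-- The weighted sum over the edges of a function of their (arbitrarily ordered) endpoints. -/
noncomputable def edgeSum (D : V → V → ℝ) : ℝ :=
  ∑ e ∈ (Set.toFinite G.edgeSet).toFinset, w e * D (Quot.out e).1 (Quot.out e).2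

variable {G w}

theorem edgeSum_le_edgeSum {D D' : V → V → ℝ} (h : ∀ e ∈ G.edgeSet,
      w e * D (Quot.out e).1 (Quot.out e).2 ≤ w e * D' (Quot.out e).1 (Quot.out e).2) :
    edgeSum G w D ≤ edgeSum G w D' :=
  Finset.sum_le_sum fun e he => h e (by simpa using he)

theorem edgeSum_mono (hw : ∀ e ∈ G.edgeSet, 0 ≤ w e) {D D' : V → V → ℝ}
    (h : ∀ x y, D x y ≤ D' x y) : edgeSum G w D ≤ edgeSum G w D' :=
  edgeSum_le_edgeSum fun e he => mul_le_mul_of_nonneg_left (h _ _) (hw e he)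

theorem eq_of_edgeSum_le (hw : ∀ e ∈ G.edgeSet, 0 ≤ w e) {D D' : V → V → ℝ}
    (h : ∀ x y, D x y ≤ D' x y) (hle : edgeSum G w D' ≤ edgeSum G w D)
    {e : Sym2 V} (he : e ∈ G.edgeSet) :
    w e * D (Quot.out e).1 (Quot.out e).2 = w e * D' (Quot.out e).1 (Quot.out e).2 :=
  (Finset.sum_eq_sum_iff_of_le fun e he => mul_le_mul_of_nonneg_left (h _ _)
    (hw e (by simpa using he))).1 (le_antisymm (edgeSum_mono hw h) hle) e (by simpa using he)

variable (G w)

theorem edgeSum_add (D D' : V → V → ℝ) :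
    edgeSum G w (fun x y => D x y + D' x y) = edgeSum G w D + edgeSum G w D' := by
  simp only [edgeSum, mul_add, Finset.sum_add_distrib]

theorem edgeSum_const_mul (c : ℝ) (D : V → V → ℝ) :
    edgeSum G w (fun x y => c * D x y) = c * edgeSum G w D := by
  simp only [edgeSum, Finset.mul_sum, mul_left_comm]

theorem edgeSum_sum {ι : Type*} (s : Finset ι) (D : ι → V → V → ℝ) :
    edgeSum G w (fun x y => ∑ i ∈ s, D i x y) = ∑ i ∈ s, edgeSum G w (D i) := by
  simp only [edgeSum, Finset.mul_sum]
  exact Finset.sum_comm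

theorem freeEnergy_eq_edgeSum {n m : ℕ} (g : V → ReplicaPerm n m) :
    freeEnergy G w g = edgeSum G w (fun x y => cayleyDist (g x) (g y)) := by
  refine Finset.sum_congr rfl fun e _ => ?_
  conv_lhs => rw [← mk_out e]
  rw [Sym2.lift_mk, mk_out]

open Classical in
theorem totalWeight_cutSurface (r s : Set V) :
    totalWeight w (cutSurface G r s) = edgeSum G w (fun x y =>
      if (x ∈ r ∨ y ∈ r) ∧ (x ∈ s ∨ y ∈ s) then 1 else 0) := by
  have key : ∀ (e : Sym2 V) (t : Set V),
      (∃ v ∈ t, v ∈ e) ↔ ((Quot.out e).1 ∈ t ∨ (Quot.out e).2 ∈ t) := by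
    intro e t
    conv_lhs => rw [← mk_out e]
    simp only [Sym2.mem_iff]
    constructor
    · rintro ⟨v, hv, rfl | rfl⟩
      · exact Or.inl hv
      · exact Or.inr hv
    · rintro (h | h)
      · exact ⟨_, h, Or.inl rfl⟩
      · exact ⟨_, h, Or.inr rfl⟩
  have e : (Set.toFinite (cutSurface G r s)).toFinset
      = (Set.toFinite G.edgeSet).toFinset.filter (fun e =>
        ((Quot.out e).1 ∈ r ∨ (Quot.out e).2 ∈ r) ∧ ((Quot.out e).1 ∈ s ∨ (Quot.out e).2 ∈ s)) := by
    ext e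
    simp only [Set.Finite.mem_toFinset, Finset.mem_filter, cutSurface, edgesMeeting,
      Set.mem_inter_iff, Set.mem_ofPred_eq, key]
    tauto
  rw [totalWeight, e, Finset.sum_filter, edgeSum]
  exact Finset.sum_congr rfl fun e _ => by split_ifs <;> simp

open Classical in
theorem totalWeight_cutSurface_compl (r : Set V) :
    totalWeight w (cutSurface G r rᶜ) = edgeSum G w (fun x y =>
      if (x ∈ r ↔ y ∈ r) then 0 else 1) := by
  rw [totalWeight_cutSurface]
  congr 1
  funext x y
  by_cases hx : x ∈ r <;> by_cases hy : y ∈ r <;> simp [hx, hy]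

/-- The area of the partition of the vertices given by a labelling. -/
noncomputable def labelArea (n : ℕ) (T : V → Fin 3) : ℝ :=
  triwayArea G w (2 * ((n : ℝ) - 1)) n n {v | T v = 0} {v | T v = 1} {v | T v = 2}

theorem labelArea_eq_edgeSum (n : ℕ) (T : V → Fin 3) :
    labelArea G w n T = edgeSum G w (fun x y => (tension n (T x) (T y) : ℝ)) := by
  classical
  rw [labelArea, triwayArea, totalWeight_cutSurface, totalWeight_cutSurface,
    totalWeight_cutSurface, ← edgeSum_const_mul, ← edgeSum_const_mul, ← edgeSum_const_mul,
    ← edgeSum_add, ← edgeSum_add]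
  congr 1
  funext x y
  simp only [Set.mem_ofPred_eq]
  rcases eq_zero_or_one_or_two (T x) with hx | hx | hx <;>
    rcases eq_zero_or_one_or_two (T y) with hy | hy | hy <;> simp [tension, hx, hy]

end EdgeSums

/-! ### Exchange of cuts, and the combined lower bound -/

section Labelings

variable {V : Type*} {A B C : Set V}

theorem isTriwayCut_label {T : V → Fin 3} (hA : ∀ v ∈ A, T v = 0) (hB : ∀ v ∈ B, T v = 1)
    (hC : ∀ v ∈ C, T v = 2) :
    IsTriwayCut A B C {v | T v = 0} {v | T v = 1} {v | T v = 2} := by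
  refine ⟨⟨?_, ?_, ?_, ?_⟩, hA, hB, hC⟩
  · ext v
    simp only [Set.mem_union, Set.mem_ofPred_eq, Set.mem_univ, iff_true]
    generalize T v = a
    fin_cases a <;> simp
  all_goals
    rw [Set.disjoint_left]
    intro v h1 h2
    exact absurd (h1.symm.trans h2) (by decide)

open Classical in
/-- The labelling of a partition into three parts. -/
noncomputable def regionLabel (α β : Set V) (v : V) : Fin 3 :=
  if v ∈ α then 0 else if v ∈ β then 1 else 2

theorem regionLabel_eq {α β γ : Set V} (h : IsTriwayCut A B C α β γ) :
    {v | regionLabel α β v = 0} = α ∧ {v | regionLabel α β v = 1} = β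
      ∧ {v | regionLabel α β v = 2} = γ := by
  obtain ⟨⟨hu, h1, h2, h3⟩, -⟩ := h
  have key : ∀ v, (v ∈ α ∨ v ∈ β) ∨ v ∈ γ := fun v => by
    have : v ∈ α ∪ β ∪ γ := hu ▸ Set.mem_univ v
    exact this
  rw [Set.disjoint_left] at h1 h2 h3
  refine ⟨?_, ?_, ?_⟩ <;> ext v <;> have k := key v <;> have k1 := @h1 v <;> have k2 := @h2 v <;>
    have k3 : v ∈ α → v ∉ γ := (fun a b => h3 b a) <;> simp only [Set.mem_ofPred_eq, regionLabel] <;>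
    by_cases ha : v ∈ α <;> by_cases hb : v ∈ β <;> simp_all

variable [Finite V] {G : SimpleGraph V} {w : Sym2 V → ℝ} {n : ℕ} {rA rB rC rAB : Set V}

theorem labelArea_regionLabel {α β γ : Set V} (h : IsTriwayCut A B C α β γ) :
    labelArea G w n (regionLabel α β)
      = triwayArea G w (2 * ((n : ℝ) - 1)) n n α β γ := by
  obtain ⟨h1, h2, h3⟩ := regionLabel_eq h
  rw [labelArea, h1, h2, h3]

/-- A minimal triway cut that is unique lies, in its first two parts, inside a minimal cut. -/
theorem union_subset_minCut (hw : ∀ e ∈ G.edgeSet, 0 ≤ w e) (hn : 2 ≤ n)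
    (htri : IsUniqueMinTriwayCut G w (2 * ((n : ℝ) - 1)) (n : ℝ) (n : ℝ) A B C rA rB rC)
    (hcut : IsMinCut G w (A ∪ B) C rAB) : rA ∪ rB ⊆ rAB := by
  classical
  obtain ⟨⟨htc, hmin⟩, huniq⟩ := htri
  obtain ⟨⟨hS, hC⟩, hmincut⟩ := hcut
  have hreg := regionLabel_eq htc
  set T := regionLabel rA rB with hT
  have hTA : ∀ v ∈ A, T v = 0 := fun v hv => (Set.ext_iff.1 hreg.1 v).2 (htc.2.1 hv)
  have hTB : ∀ v ∈ B, T v = 1 := fun v hv => (Set.ext_iff.1 hreg.2.1 v).2 (htc.2.2.1 hv)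
  have hTC : ∀ v ∈ C, T v = 2 := fun v hv => (Set.ext_iff.1 hreg.2.2 v).2 (htc.2.2.2 hv)
  -- Exchange: the regions 0 and 1 of `T` are cut down to `rAB`, while `rAB` is enlarged by them.
  -- The inequality `h2` is submodularity, checked edge by edge.
  set T' : V → Fin 3 := fun v => if v ∈ rAB then T v else 2 with hT'
  have htc' : IsTriwayCut A B C {v | T' v = 0} {v | T' v = 1} {v | T' v = 2} := by
    refine isTriwayCut_label (fun v hv => ?_) (fun v hv => ?_) (fun v hv => ?_)
    · rw [hT', ← hTA v hv]; exact if_pos (hS (Or.inl hv))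
    · rw [hT', ← hTB v hv]; exact if_pos (hS (Or.inr hv))
    · exact if_neg (hC hv)
  have hcut' : IsCut (A ∪ B) C {v | T v ≠ 2 ∨ v ∈ rAB} := by
    refine ⟨fun v hv => Or.inr (hS hv), fun v hv hv' => ?_⟩
    exact hv'.elim (fun h => h (hTC v hv)) (hC hv)
  have h1 := hmincut _ hcut'
  have h2 : labelArea G w n T'
      + n * totalWeight w (cutSurface G {v | T v ≠ 2 ∨ v ∈ rAB} {v | T v ≠ 2 ∨ v ∈ rAB}ᶜ)
      ≤ labelArea G w n T + n * totalWeight w (cutSurface G rAB rABᶜ) := by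
    rw [labelArea_eq_edgeSum, labelArea_eq_edgeSum, totalWeight_cutSurface_compl,
      totalWeight_cutSurface_compl, ← edgeSum_const_mul, ← edgeSum_const_mul, ← edgeSum_add,
      ← edgeSum_add]
    refine edgeSum_mono hw fun x y => ?_
    have hn' : (2 : ℝ) ≤ n := by exact_mod_cast hn
    simp only [hT', Set.mem_ofPred_eq]
    rcases eq_zero_or_one_or_two (T x) with hTx | hTx | hTx <;>
      rcases eq_zero_or_one_or_two (T y) with hTy | hTy | hTy <;>
      by_cases hx : x ∈ rAB <;> by_cases hy : y ∈ rAB <;>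
      simp [hx, hy, hTx, hTy, tension] <;> linarith
  have hn0 : (0 : ℝ) ≤ n := Nat.cast_nonneg n
  have h3 : labelArea G w n T' ≤ labelArea G w n T := by
    have := mul_le_mul_of_nonneg_left h1 hn0
    linarith
  rw [hT, labelArea_regionLabel htc] at h3
  obtain ⟨e1, e2, -⟩ := huniq _ _ _ ⟨htc', fun α β γ h => h3.trans (hmin α β γ h)⟩
  rintro v (hv | hv)
  · rw [← e1] at hv
    by_contra hcon
    exact absurd ((if_neg hcon).symm.trans hv) (by decide)
  · rw [← e2] at hv
    by_contra hcon
    exact absurd ((if_neg hcon).symm.trans hv) (by decide)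

open Classical in
/-- The sum of the densities of a family of triway areas, indexed by `0 ≤ u < K`, and of `K`
times the areas of a family of cuts. -/
noncomputable def cutDensity (n : ℕ) (K : ℤ) {N : ℕ} (T : ℤ → V → Fin 3) (r : Fin N → Set V)
    (x y : V) : ℝ :=
  ∑ u ∈ Finset.Ico 0 K, (tension n (T u x) (T u y) : ℝ)
    + K * ∑ j, if (x ∈ r j ↔ y ∈ r j) then 0 else 1

theorem edgeSum_cutDensity (K : ℤ) {N : ℕ} (T : ℤ → V → Fin 3) (r : Fin N → Set V) :
    edgeSum G w (cutDensity n K T r) = ∑ u ∈ Finset.Ico 0 K, labelArea G w n (T u)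
      + K * ∑ j, totalWeight w (cutSurface G (r j) (r j)ᶜ) := by
  simp only [labelArea_eq_edgeSum, totalWeight_cutSurface_compl]
  rw [← edgeSum_sum, ← edgeSum_sum, ← edgeSum_const_mul, ← edgeSum_add]
  rfl

theorem le_edgeSum_cutDensity
    (htri : IsMinTriwayCut G w (2 * ((n : ℝ) - 1)) (n : ℝ) (n : ℝ) A B C rA rB rC)
    (hcut : IsMinCut G w (A ∪ B) C rAB) {K : ℤ} (hK : 0 ≤ K) {N : ℕ} {T : ℤ → V → Fin 3}
    {r : Fin N → Set V}
    (hT : ∀ u ∈ Finset.Ico 0 K, IsTriwayCut A B C {v | T u v = 0} {v | T u v = 1} {v | T u v = 2})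
    (hr : ∀ j, IsCut (A ∪ B) C (r j)) :
    K * (triwayArea G w (2 * ((n : ℝ) - 1)) n n rA rB rC
      + N * totalWeight w (cutSurface G rAB rABᶜ)) ≤ edgeSum G w (cutDensity n K T r) := by
  have hK' : (0 : ℝ) ≤ K := by exact_mod_cast hK
  have h1 : K * triwayArea G w (2 * ((n : ℝ) - 1)) n n rA rB rC
      ≤ ∑ u ∈ Finset.Ico 0 K, labelArea G w n (T u) := by
    have := Finset.card_nsmul_le_sum (Finset.Ico 0 K) (fun u => labelArea G w n (T u)) _
      fun u hu => htri.2 _ _ _ (hT u hu)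
    rw [Int.card_Ico, sub_zero, nsmul_eq_mul] at this
    rwa [show ((K.toNat : ℕ) : ℝ) = (K : ℝ) by exact_mod_cast Int.toNat_of_nonneg hK] at this
  have h2 : N * totalWeight w (cutSurface G rAB rABᶜ)
      ≤ ∑ j, totalWeight w (cutSurface G (r j) (r j)ᶜ) := by
    have := Finset.card_nsmul_le_sum Finset.univ
      (fun j => totalWeight w (cutSurface G (r j) (r j)ᶜ)) _ fun j _ => hcut.2 _ (hr j)
    rwa [Finset.card_univ, Fintype.card_fin, nsmul_eq_mul] at this
  rw [edgeSum_cutDensity, mul_add]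
  exact add_le_add h1 (mul_le_mul_of_nonneg_left h2 hK')

/-- Every area and every cut weight has a nonnegative excess over its minimum. The total excess is
at most zero, so each one vanishes and uniqueness applies to each member of the families. -/
theorem eq_of_edgeSum_cutDensity_le
    (htri : IsUniqueMinTriwayCut G w (2 * ((n : ℝ) - 1)) (n : ℝ) (n : ℝ) A B C rA rB rC)
    (hcut : IsUniqueMinCut G w (A ∪ B) C rAB) {K : ℤ} (hK : 0 < K) {N : ℕ}
    {T : ℤ → V → Fin 3} {r : Fin N → Set V}
    (hT : ∀ u ∈ Finset.Ico 0 K, IsTriwayCut A B C {v | T u v = 0} {v | T u v = 1} {v | T u v = 2})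
    (hr : ∀ j, IsCut (A ∪ B) C (r j))
    (hle : edgeSum G w (cutDensity n K T r) ≤
      K * (triwayArea G w (2 * ((n : ℝ) - 1)) n n rA rB rC
        + N * totalWeight w (cutSurface G rAB rABᶜ))) :
    (∀ u ∈ Finset.Ico 0 K, {v | T u v = 0} = rA ∧ {v | T u v = 1} = rB ∧ {v | T u v = 2} = rC)
      ∧ ∀ j, r j = rAB := by
  have hK' : (0 : ℝ) < K := by exact_mod_cast hK
  set τ := triwayArea G w (2 * ((n : ℝ) - 1)) n n rA rB rC with hτ
  set κ := totalWeight w (cutSurface G rAB rABᶜ) with hκ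
  have h1 : ∀ u ∈ Finset.Ico 0 K, 0 ≤ labelArea G w n (T u) - τ := fun u hu =>
    sub_nonneg.2 (htri.1.2 _ _ _ (hT u hu))
  have h2 : ∀ j ∈ Finset.univ, 0 ≤ totalWeight w (cutSurface G (r j) (r j)ᶜ) - κ := fun j _ =>
    sub_nonneg.2 (hcut.1.2 _ (hr j))
  have h3 : ∑ u ∈ Finset.Ico 0 K, (labelArea G w n (T u) - τ)
      + K * ∑ j, (totalWeight w (cutSurface G (r j) (r j)ᶜ) - κ) ≤ 0 := by
    rw [edgeSum_cutDensity] at hle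
    rw [Finset.sum_sub_distrib, Finset.sum_sub_distrib, Finset.sum_const, Finset.sum_const,
      Int.card_Ico, Finset.card_univ, Fintype.card_fin, nsmul_eq_mul, nsmul_eq_mul, sub_zero,
      show ((K.toNat : ℕ) : ℝ) = (K : ℝ) by exact_mod_cast Int.toNat_of_nonneg hK.le]
    linarith
  have h4 := Finset.sum_nonneg h1
  have h5 := Finset.sum_nonneg h2
  have h6 := mul_nonneg hK'.le h5
  refine ⟨fun u hu => ?_, fun j => ?_⟩
  · have h7 := Finset.single_le_sum h1 hu
    have h8 : labelArea G w n (T u) ≤ τ := by linarith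
    exact htri.2 _ _ _ ⟨hT u hu, fun α β γ h => h8.trans (htri.1.2 α β γ h)⟩
  · have h7 := Finset.single_le_sum h2 (Finset.mem_univ j)
    have h8 : ∑ j, (totalWeight w (cutSurface G (r j) (r j)ᶜ) - κ) ≤ 0 := by
      by_contra hcon
      have := mul_pos hK' (not_le.1 hcon)
      linarith
    have h9 : totalWeight w (cutSurface G (r j) (r j)ᶜ) ≤ κ := by linarith
    exact hcut.2 _ ⟨hr j, fun r' h => h9.trans (hcut.1.2 r' h)⟩

end Labelings
-- Labels and bulk cuts of replica permutations
section Optimum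

variable {n m h : ℕ}

/-- The label of `g` at the threshold `u`, after the bulk replicas have been removed from the
cycles of `g X⁻¹`. -/
noncomputable def replicaLabel (h : ℕ) (u : ℤ) (g : ReplicaPerm n m) : Fin 3 :=
  permLabel n (relA n m) (relB n m) u (bypassList (bulkReplicas n m h) (g * (gX n m)⁻¹))

/-- The `j`-th bulk replica is moved by `g X⁻¹` when its turn comes to be removed. -/
def BulkMoved (h : ℕ) (g : ReplicaPerm n m) (j : Fin (bulkReplicas n m h).length) : Prop :=
  MovedAt (bulkReplicas n m h) (g * (gX n m)⁻¹) j


theorem not_bulkMoved_gA (hm : m = h + h) (hh : 0 < h)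
    (j : Fin (bulkReplicas n m h).length) : ¬ BulkMoved h (gA n m) j :=
  (isColumnMatching_relA hm hh).not_movedAt j

theorem not_bulkMoved_gB (hm : m = h + h) (hh : 0 < h)
    (j : Fin (bulkReplicas n m h).length) : ¬ BulkMoved h (gB n m) j :=
  (isColumnMatching_relB hm hh).not_movedAt j

theorem bulkMoved_one (hm : m = h + h) (hh : 0 < h)
    (j : Fin (bulkReplicas n m h).length) : BulkMoved h (1 : ReplicaPerm n m) j := by
  rw [BulkMoved, one_mul]
  exact movedAt_gX_inv hm hh j

theorem replicaLabel_gA (hn : 2 ≤ n) (hm : m = h + h) (hh : 0 < h) {u : ℤ} (hu : 0 ≤ u) :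
    replicaLabel h u (gA n m) = 0 := by
  have e := (isColumnMatching_relA (n := n) hm hh).bypassList_eq
  rw [replicaLabel, ← relA, e]
  exact (isReplicaPair hn hm hh).permLabel_left hu

theorem replicaLabel_gB (hn : 2 ≤ n) (hm : m = h + h) (hh : 0 < h) {u : ℤ}
    (hu : u < 4 * ((n : ℤ) * (n - 1))) : replicaLabel h u (gB n m) = 1 := by
  have e := (isColumnMatching_relB (n := n) hm hh).bypassList_eq
  rw [replicaLabel, ← relB, e]
  exact (isReplicaPair hn hm hh).permLabel_right hu

theorem replicaLabel_one (hn : 2 ≤ n) (hm : m = h + h) (hh : 0 < h) {u : ℤ} (hu : 0 ≤ u)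
    (hu' : u < 4 * ((n : ℤ) * (n - 1))) : replicaLabel h u (1 : ReplicaPerm n m) = 2 := by
  rw [replicaLabel, one_mul, bypassList_gX_inv hm]
  exact (isReplicaPair hn hm hh).permLabel_one hu hu'

theorem bypassList_eq_of_not_bulkMoved {g : ReplicaPerm n m} (hg : ∀ j, ¬ BulkMoved h g j) :
    bypassList (bulkReplicas n m h) (g * (gX n m)⁻¹) = g * (gX n m)⁻¹ :=
  bypassList_eq_self hg

theorem eq_gA_of_replicaLabel (hn : 2 ≤ n) (hm : m = h + h) (hh : 0 < h) {g : ReplicaPerm n m}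
    (hg : ∀ j, ¬ BulkMoved h g j) (h0 : replicaLabel h 0 g = 0) : g = gA n m := by
  rw [replicaLabel, bypassList_eq_of_not_bulkMoved hg] at h0
  exact mul_right_cancel ((isReplicaPair hn hm hh).eq_left h0)

theorem eq_gB_of_replicaLabel (hn : 2 ≤ n) (hm : m = h + h) (hh : 0 < h) {g : ReplicaPerm n m}
    (hg : ∀ j, ¬ BulkMoved h g j)
    (h1 : replicaLabel h (4 * ((n : ℤ) * (n - 1)) - 1) g = 1) : g = gB n m := by
  rw [replicaLabel, bypassList_eq_of_not_bulkMoved hg] at h1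
  exact mul_right_cancel ((isReplicaPair hn hm hh).eq_right h1)

theorem eq_gX_of_replicaLabel (hn : 2 ≤ n) (hm : m = h + h) (hh : 0 < h) {g : ReplicaPerm n m}
    (hg : ∀ j, ¬ BulkMoved h g j) (h0 : replicaLabel h 0 g = 2)
    (h1 : replicaLabel h (4 * ((n : ℤ) * (n - 1)) - 1) g = 2) : g = gX n m := by
  rw [replicaLabel, bypassList_eq_of_not_bulkMoved hg] at h0 h1
  exact mul_inv_eq_one.1 ((isReplicaPair hn hm hh).eq_one h0 h1)

/-- The Cayley distance dominates the triway tensions of the labels, together with one unit for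
each bulk replica that is moved by exactly one of the two permutations. -/
theorem cutDensity_le_cayleyDist {V : Type*} (hn : 2 ≤ n) (hm : m = h + h) (hh : 0 < h)
    (g : V → ReplicaPerm n m) (x y : V) :
    cutDensity n (4 * ((n : ℤ) * (n - 1))) (fun u v => replicaLabel h u (g v))
        (fun j => {v | ¬ BulkMoved h (g v) j}) x y
      ≤ ((4 * ((n : ℤ) * (n - 1)) : ℤ) : ℝ) * cayleyDist (g x) (g y) := by
  classical
  have hK := (threshold_count_pos hn).le
  have h1 := (isReplicaPair hn hm hh).sum_tension_le
    (bypassList (bulkReplicas n m h) (g x * (gX n m)⁻¹))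
    (bypassList (bulkReplicas n m h) (g y * (gX n m)⁻¹))
  have h2 := len_bypassList_mul_inv_add_le (bulkReplicas n m h) (g x * (gX n m)⁻¹)
    (g y * (gX n m)⁻¹)
  rw [show g x * (gX n m)⁻¹ * (g y * (gX n m)⁻¹)⁻¹ = g x * (g y)⁻¹ by group] at h2
  have h3 := mul_le_mul_of_nonneg_left (Int.ofNat_le.2 h2) hK
  rw [cayleyDist_eq_len, cutDensity]
  generalize 4 * ((n : ℤ) * (n - 1)) = K at *
  have h4 : ∑ u ∈ Finset.Ico 0 K, tension n (replicaLabel h u (g x)) (replicaLabel h u (g y))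
      + K * ∑ j, (if (BulkMoved h (g x) j ↔ BulkMoved h (g y) j) then 0 else 1)
      ≤ K * len (g x * (g y)⁻¹) := by
    refine le_trans ?_ h3
    push_cast
    rw [mul_add]
    exact add_le_add_left h1 _
  have h5 := (Int.cast_le (R := ℝ)).2 h4
  push_cast at h5
  refine le_trans (le_of_eq ?_) h5
  simp only [Set.mem_ofPred_eq, not_iff_not]

theorem len_gA_mul_inv_gX (hm : m = h + h) (hh : 0 < h) : len (gA n m * (gX n m)⁻¹) = n :=
  (isColumnMatching_relA hm hh).len_eq hh (by omega)

theorem len_gB_mul_inv_gX (hm : m = h + h) (hh : 0 < h) : len (gB n m * (gX n m)⁻¹) = n :=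
  (isColumnMatching_relB hm hh).len_eq hh (by omega)

theorem len_gA_mul_inv_gB (hm : m = h + h) (hh : 0 < h) (hn : 0 < n) :
    len (gA n m * (gB n m)⁻¹) = 2 * (n - 1) := by
  rw [← len_relA_mul_inv_relB hm hh hn, relA, relB]
  group

/-- The permutation on the region with label `t`, inside or outside the minimal cut. -/
def regionPerm (n m : ℕ) (t : Fin 3) (b : Bool) : ReplicaPerm n m :=
  if t = 0 then gA n m else if t = 1 then gB n m else if b then gX n m else 1

/-- The distances from g_A and g_B to the identity are bounded by passing through X. The hypotheses
on `b` and `b'` exclude the labels 0 and 1 outside the cut, where the bound would fail. -/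
theorem len_regionPerm_le (hn : 2 ≤ n) (hm : m = h + h) (hh : 0 < h) (t t' : Fin 3) (b b' : Bool)
    (hb : t ≠ 2 → b = true) (hb' : t' ≠ 2 → b' = true) :
    (len (regionPerm n m t b * (regionPerm n m t' b')⁻¹) : ℤ)
      ≤ tension n t t' + (bulkReplicas n m h).length * (if b = b' then 0 else 1) := by
  have hAX := len_gA_mul_inv_gX (n := n) hm hh
  have hBX := len_gB_mul_inv_gX (n := n) hm hh
  have hAB := len_gA_mul_inv_gB (n := n) hm hh (by omega)
  have hX := len_gX (n := n) hm hh
  have hXA := len_mul_inv_comm (gA n m) (gX n m)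
  have hXB := len_mul_inv_comm (gB n m) (gX n m)
  have hBA := len_mul_inv_comm (gA n m) (gB n m)
  have hA1 := len_triangle (gA n m) (gX n m) 1
  have hB1 := len_triangle (gB n m) (gX n m) 1
  have iA := len_inv (gA n m)
  have iB := len_inv (gB n m)
  have iX := len_inv (gX n m)
  simp only [inv_one, mul_one] at hA1 hB1
  fin_cases t <;> fin_cases t' <;> cases b <;> cases b' <;>
    simp [regionPerm, tension, len_one] at hb hb' ⊢ <;> omega

end Optimum
-- The lower bound, its attainment, and uniqueness
section Main

variable {V : Type*} {n m h : ℕ} {A B C rA rB rC rAB : Set V}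

theorem IsConfiguration.isTriwayCut_replicaLabel (hn : 2 ≤ n) (hm : m = h + h) (hh : 0 < h)
    {g : V → ReplicaPerm n m} (hg : IsConfiguration A B C g) (u : ℤ)
    (hu : u ∈ Finset.Ico 0 (4 * ((n : ℤ) * (n - 1)))) :
    IsTriwayCut A B C {v | replicaLabel h u (g v) = 0} {v | replicaLabel h u (g v) = 1}
      {v | replicaLabel h u (g v) = 2} := by
  rw [Finset.mem_Ico] at hu
  refine isTriwayCut_label (fun v hv => ?_) (fun v hv => ?_) (fun v hv => ?_)
  · rw [hg.1 v hv, replicaLabel_gA hn hm hh hu.1]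
  · rw [hg.2.1 v hv, replicaLabel_gB hn hm hh hu.2]
  · rw [hg.2.2 v hv, replicaLabel_one hn hm hh hu.1 hu.2]

theorem IsConfiguration.isCut_not_bulkMoved (hm : m = h + h) (hh : 0 < h)
    {g : V → ReplicaPerm n m} (hg : IsConfiguration A B C g)
    (j : Fin (bulkReplicas n m h).length) :
    IsCut (A ∪ B) C {v | ¬ BulkMoved h (g v) j} := by
  refine ⟨?_, fun v hv => not_not.2 ?_⟩
  · rintro v (hv | hv)
    · change ¬ BulkMoved h (g v) j
      rw [hg.1 v hv]
      exact not_bulkMoved_gA hm hh j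
    · change ¬ BulkMoved h (g v) j
      rw [hg.2.1 v hv]
      exact not_bulkMoved_gB hm hh j
  · rw [hg.2.2 v hv]
    exact bulkMoved_one hm hh j

open Classical in
/-- The configuration given by a triway cut and a cut. -/
noncomputable def cutConfiguration (n m : ℕ) (rA rB rAB : Set V) (v : V) : ReplicaPerm n m :=
  regionPerm n m (regionLabel rA rB v) (decide (v ∈ rAB))

theorem cutConfiguration_of_mem_left {v : V} (hv : v ∈ rA) :
    cutConfiguration n m rA rB rAB v = gA n m := by
  simp [cutConfiguration, regionPerm, regionLabel, hv]

theorem cutConfiguration_of_mem_right (hd : Disjoint rA rB) {v : V} (hv : v ∈ rB) :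
    cutConfiguration n m rA rB rAB v = gB n m := by
  simp [cutConfiguration, regionPerm, regionLabel, hv, Set.disjoint_right.1 hd hv]

theorem cutConfiguration_of_mem_diff {v : V} (hv : v ∈ rAB \ (rA ∪ rB)) :
    cutConfiguration n m rA rB rAB v = gX n m := by
  have hA : v ∉ rA := fun h => hv.2 (Or.inl h)
  have hB : v ∉ rB := fun h => hv.2 (Or.inr h)
  simp [cutConfiguration, regionPerm, regionLabel, hA, hB, hv.1]

theorem cutConfiguration_of_notMem (hsub : rA ∪ rB ⊆ rAB) {v : V} (hv : v ∉ rAB) :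
    cutConfiguration n m rA rB rAB v = 1 := by
  have hA : v ∉ rA := fun h => hv (hsub (Or.inl h))
  have hB : v ∉ rB := fun h => hv (hsub (Or.inr h))
  simp [cutConfiguration, regionPerm, regionLabel, hA, hB, hv]

theorem isConfiguration_cutConfiguration (htri : IsTriwayCut A B C rA rB rC)
    (hcut : IsCut (A ∪ B) C rAB) (hsub : rA ∪ rB ⊆ rAB) :
    IsConfiguration A B C (cutConfiguration n m rA rB rAB) :=
  ⟨fun _ hv => cutConfiguration_of_mem_left (htri.2.1 hv),
    fun _ hv => cutConfiguration_of_mem_right htri.1.2.1 (htri.2.2.1 hv),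
    fun _ hv => cutConfiguration_of_notMem hsub (hcut.2 hv)⟩

variable [Finite V] {G : SimpleGraph V} {w : Sym2 V → ℝ}

theorem edgeSum_cutDensity_le_freeEnergy (hw : ∀ e ∈ G.edgeSet, 0 ≤ w e) (hn : 2 ≤ n)
    (hm : m = h + h) (hh : 0 < h) (g : V → ReplicaPerm n m) :
    edgeSum G w (cutDensity n (4 * ((n : ℤ) * (n - 1))) (fun u v => replicaLabel h u (g v))
        (fun j => {v | ¬ BulkMoved h (g v) j}))
      ≤ ((4 * ((n : ℤ) * (n - 1)) : ℤ) : ℝ) * freeEnergy G w g := by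
  rw [freeEnergy_eq_edgeSum, ← edgeSum_const_mul]
  exact edgeSum_mono hw (cutDensity_le_cayleyDist hn hm hh g)

theorem le_freeEnergy (hw : ∀ e ∈ G.edgeSet, 0 ≤ w e) (hn : 2 ≤ n) (hm : m = h + h) (hh : 0 < h)
    (htri : IsMinTriwayCut G w (2 * ((n : ℝ) - 1)) (n : ℝ) (n : ℝ) A B C rA rB rC)
    (hcut : IsMinCut G w (A ∪ B) C rAB) {g : V → ReplicaPerm n m}
    (hg : IsConfiguration A B C g) :
    triwayArea G w (2 * ((n : ℝ) - 1)) n n rA rB rC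
      + (bulkReplicas n m h).length * totalWeight w (cutSurface G rAB rABᶜ)
      ≤ freeEnergy G w g := by
  have hK := threshold_count_pos hn
  refine le_of_mul_le_mul_left ?_ (Int.cast_pos (R := ℝ).2 hK)
  exact (le_edgeSum_cutDensity htri hcut hK.le (hg.isTriwayCut_replicaLabel hn hm hh)
    (hg.isCut_not_bulkMoved hm hh)).trans (edgeSum_cutDensity_le_freeEnergy hw hn hm hh g)

theorem freeEnergy_cutConfiguration_le (hw : ∀ e ∈ G.edgeSet, 0 ≤ w e) (hn : 2 ≤ n)
    (hm : m = h + h) (hh : 0 < h) (htri : IsTriwayCut A B C rA rB rC) (hsub : rA ∪ rB ⊆ rAB) :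
    freeEnergy G w (cutConfiguration n m rA rB rAB)
      ≤ triwayArea G w (2 * ((n : ℝ) - 1)) n n rA rB rC
        + (bulkReplicas n m h).length * totalWeight w (cutSurface G rAB rABᶜ) := by
  classical
  rw [← labelArea_regionLabel htri, labelArea_eq_edgeSum, totalWeight_cutSurface_compl,
    ← edgeSum_const_mul, ← edgeSum_add, freeEnergy_eq_edgeSum]
  have hb : ∀ v, regionLabel rA rB v ≠ 2 → decide (v ∈ rAB) = true := by
    intro v hv
    by_contra hcon
    have hv' : v ∉ rAB := by simpa using hcon
    refine hv ?_
    rw [regionLabel, if_neg fun h => hv' (hsub (Or.inl h)), if_neg fun h => hv' (hsub (Or.inr h))]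
  refine edgeSum_mono hw fun x y => ?_
  have h1 := (Int.cast_le (R := ℝ)).2 (len_regionPerm_le hn hm hh (regionLabel rA rB x)
    (regionLabel rA rB y) (decide (x ∈ rAB)) (decide (y ∈ rAB)) (hb x) (hb y))
  push_cast at h1
  rw [cayleyDist_eq_len]
  refine (le_of_eq ?_).trans (h1.trans (le_of_eq ?_))
  · simp only [cutConfiguration]
  · simp only [decide_eq_decide]

theorem IsOptimalConfiguration.eq_cutConfiguration (hw : ∀ e ∈ G.edgeSet, 0 ≤ w e) (hn : 2 ≤ n)
    (hm : m = h + h) (hh : 0 < h)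
    (htri : IsUniqueMinTriwayCut G w (2 * ((n : ℝ) - 1)) (n : ℝ) (n : ℝ) A B C rA rB rC)
    (hcut : IsUniqueMinCut G w (A ∪ B) C rAB) {g : V → ReplicaPerm n m}
    (hg : IsOptimalConfiguration G w A B C g) : g = cutConfiguration n m rA rB rAB := by
  classical
  have hsub := union_subset_minCut hw hn htri hcut.1
  have htc := htri.1.1
  have hK := threshold_count_pos hn
  have hle : freeEnergy G w g ≤ triwayArea G w (2 * ((n : ℝ) - 1)) n n rA rB rC
      + (bulkReplicas n m h).length * totalWeight w (cutSurface G rAB rABᶜ) :=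
    (hg.2 _ (isConfiguration_cutConfiguration htc hcut.1.1 hsub)).trans
      (freeEnergy_cutConfiguration_le hw hn hm hh htc hsub)
  have hle' := mul_le_mul_of_nonneg_left hle (Int.cast_pos (R := ℝ).2 hK).le
  have hT := hg.1.isTriwayCut_replicaLabel hn hm hh
  have hr := hg.1.isCut_not_bulkMoved hm hh
  obtain ⟨hlab, hbulk⟩ := eq_of_edgeSum_cutDensity_le htri hcut hK hT hr
    ((edgeSum_cutDensity_le_freeEnergy hw hn hm hh g).trans hle')
  have hlow := le_edgeSum_cutDensity htri.1 hcut.1 hK.le hT hr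
  have hmem : ∀ v j, ¬ BulkMoved h (g v) j ↔ v ∈ rAB := fun v j => Set.ext_iff.1 (hbulk j) v
  -- The extreme thresholds are the most restrictive: label 0 at the lowest singles out g_A, label 1
  -- at the highest g_B, and label 2 at both X.
  have h0 := hlab 0 (Finset.mem_Ico.2 ⟨le_rfl, hK⟩)
  have h1 := hlab (4 * ((n : ℤ) * (n - 1)) - 1) (Finset.mem_Ico.2 ⟨by omega, by omega⟩)
  have hC : ∀ v, v ∉ rA → v ∉ rB → v ∈ rC := fun v hA hB => by
    have : v ∈ rA ∪ rB ∪ rC := htc.1.1 ▸ Set.mem_univ v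
    exact this.elim (fun h => absurd h (not_or.2 ⟨hA, hB⟩)) id
  have hout : ∀ v, v ∉ rAB → v ∈ rC := fun v hv =>
    hC v (fun h => hv (hsub (Or.inl h))) (fun h => hv (hsub (Or.inr h)))
  -- Moving the vertices outside the minimal cut that do not carry the identity into the cut
  -- does not increase its area.
  have hone : ∀ v, v ∉ rAB → g v = 1 := by
    have hedge : ∀ e ∈ G.edgeSet, (Quot.out e).1 ∉ rAB → (Quot.out e).2 ∉ rAB →
        g (Quot.out e).1 ≠ g (Quot.out e).2 → w e = 0 := by
      intro e he hx hy hne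
      -- Equality of the sums forces equality on each edge. With both ends outside `rAB`, labels and
      -- bulk cuts agree, so the density is 0 and `w e * (K * distance)` vanishes, K being the
      -- number of thresholds.
      have heq := eq_of_edgeSum_le (D := cutDensity n (4 * ((n : ℤ) * (n - 1)))
          (fun u v => replicaLabel h u (g v)) (fun j => {v | ¬ BulkMoved h (g v) j}))
        (D' := fun x y => ((4 * ((n : ℤ) * (n - 1)) : ℤ) : ℝ) * cayleyDist (g x) (g y)) hw
        (cutDensity_le_cayleyDist hn hm hh g) (by
          rw [edgeSum_const_mul, ← freeEnergy_eq_edgeSum]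
          exact hle'.trans hlow) he
      have hzero : cutDensity n (4 * ((n : ℤ) * (n - 1))) (fun u v => replicaLabel h u (g v))
          (fun j => {v | ¬ BulkMoved h (g v) j}) (Quot.out e).1 (Quot.out e).2 = 0 := by
        rw [cutDensity, Finset.sum_eq_zero, Finset.sum_eq_zero, mul_zero, add_zero]
        · intro j _
          rw [hbulk j, if_pos (iff_of_false hx hy)]
        · intro u hu
          have hu2 := Set.ext_iff.1 (hlab u hu).2.2
          have e1 : replicaLabel h u (g (Quot.out e).1) = 2 := (hu2 _).2 (hout _ hx)
          have e2 : replicaLabel h u (g (Quot.out e).2) = 2 := (hu2 _).2 (hout _ hy)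
          rw [e1, e2, tension_self, Int.cast_zero]
      rw [hzero, mul_zero, eq_comm, mul_eq_zero, mul_eq_zero, cayleyDist_eq_len] at heq
      rcases heq with heq | heq | heq
      · exact heq
      · exact absurd heq (Int.cast_pos (R := ℝ).2 hK).ne'
      · exact absurd (mul_inv_eq_one.1 (eq_one_of_len_eq_zero (Nat.cast_eq_zero.1 heq))) hne
    set r : Set V := {v | v ∈ rAB ∨ g v ≠ 1} with hr_def
    have hrcut : IsCut (A ∪ B) C r :=
      ⟨fun v hv => Or.inl (hcut.1.1.1 hv), fun v hv hv' =>
        hv'.elim (hcut.1.1.2 hv) (fun h => h (hg.1.2.2 v hv))⟩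
    have hrle : totalWeight w (cutSurface G r rᶜ) ≤ totalWeight w (cutSurface G rAB rABᶜ) := by
      rw [totalWeight_cutSurface_compl, totalWeight_cutSurface_compl]
      refine edgeSum_le_edgeSum fun e he => ?_
      have hwe := hw e he
      have hed := hedge e he
      have hx : (Quot.out e).1 ∈ r ↔ (Quot.out e).1 ∈ rAB ∨ g (Quot.out e).1 ≠ 1 := Iff.rfl
      have hy : (Quot.out e).2 ∈ r ↔ (Quot.out e).2 ∈ rAB ∨ g (Quot.out e).2 ≠ 1 := Iff.rfl
      by_cases hr1 : (Quot.out e).1 ∈ r ↔ (Quot.out e).2 ∈ r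
      · rw [if_pos hr1, mul_zero]
        split_ifs <;> simp [hwe]
      · by_cases hr2 : (Quot.out e).1 ∈ rAB ↔ (Quot.out e).2 ∈ rAB
        · have hz : w e = 0 := by
            by_cases hx' : (Quot.out e).1 ∈ rAB
            · exact absurd (iff_of_true (hx.2 (Or.inl hx')) (hy.2 (Or.inl (hr2.1 hx')))) hr1
            · have hy' : (Quot.out e).2 ∉ rAB := fun h => hx' (hr2.2 h)
              refine hed hx' hy' fun hgg => hr1 ?_
              rw [hx, hy, hgg]
              simp [hx', hy']
          rw [hz, zero_mul, zero_mul]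
        · rw [if_neg hr1, if_neg hr2]
    have hr_eq := hcut.2 r ⟨hrcut, fun r' h' => hrle.trans (hcut.1.2 r' h')⟩
    intro v hv
    by_contra hcon
    exact hv (hr_eq ▸ (Or.inr hcon : v ∈ r))
  funext v
  by_cases hv : v ∈ rAB
  · have hnb : ∀ j, ¬ BulkMoved h (g v) j := fun j => (hmem v j).2 hv
    by_cases hA : v ∈ rA
    · rw [cutConfiguration_of_mem_left hA]
      exact eq_gA_of_replicaLabel hn hm hh hnb ((Set.ext_iff.1 h0.1 v).2 hA)
    · by_cases hB : v ∈ rB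
      · rw [cutConfiguration_of_mem_right htc.1.2.1 hB]
        exact eq_gB_of_replicaLabel hn hm hh hnb ((Set.ext_iff.1 h1.2.1 v).2 hB)
      · rw [cutConfiguration_of_mem_diff ⟨hv, not_or.2 ⟨hA, hB⟩⟩]
        exact eq_gX_of_replicaLabel hn hm hh hnb ((Set.ext_iff.1 h0.2.2 v).2 (hC v hA hB))
          ((Set.ext_iff.1 h1.2.2 v).2 (hC v hA hB))
  · rw [cutConfiguration_of_notMem hsub hv, hone v hv]

end Main

end ReflectedEntropy

theorem mainTheorem4 {V : Type*} [Finite V] (G : SimpleGraph V) (w : Sym2 V → ℝ)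
    (hw : ∀ e ∈ G.edgeSet, 0 ≤ w e)
    (n m : ℕ) (hn : 2 ≤ n) (hm : 2 ≤ m) (hm_even : Even m)
    (A B C : Set V) (hAB : Disjoint A B) (hBC : Disjoint B C) (hCA : Disjoint C A)
    (rA rB rC rAB : Set V)
    (htri : ReflectedEntropy.IsUniqueMinTriwayCut G w (2 * ((n : ℝ) - 1)) (n : ℝ) (n : ℝ)
      A B C rA rB rC)
    (hcut : ReflectedEntropy.IsUniqueMinCut G w (A ∪ B) C rAB) :
    (∃! g : V → ReflectedEntropy.ReplicaPerm n m,
      ReflectedEntropy.IsOptimalConfiguration G w A B C g) ∧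
    ∀ g : V → ReflectedEntropy.ReplicaPerm n m,
      ReflectedEntropy.IsOptimalConfiguration G w A B C g →
      ∀ v : V,
        (v ∈ rA → g v = ReflectedEntropy.gA n m) ∧
        (v ∈ rB → g v = ReflectedEntropy.gB n m) ∧
        (v ∈ rAB \ (rA ∪ rB) → g v = ReflectedEntropy.gX n m) ∧
        (v ∉ rAB → g v = 1) := by
  obtain ⟨h, hmh⟩ := hm_even
  have hh : 0 < h := by omega
  have hsub := ReflectedEntropy.union_subset_minCut hw hn htri hcut.1
  have huniq : ∀ g : V → ReflectedEntropy.ReplicaPerm n m,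
      ReflectedEntropy.IsOptimalConfiguration G w A B C g →
      g = ReflectedEntropy.cutConfiguration n m rA rB rAB := fun g hg =>
    hg.eq_cutConfiguration hw hn hmh hh htri hcut
  refine ⟨⟨ReflectedEntropy.cutConfiguration n m rA rB rAB,
    ⟨ReflectedEntropy.isConfiguration_cutConfiguration htri.1.1 hcut.1.1 hsub, fun g' hg' =>
      (ReflectedEntropy.freeEnergy_cutConfiguration_le hw hn hmh hh htri.1.1 hsub).trans
        (ReflectedEntropy.le_freeEnergy hw hn hmh hh htri.1 hcut.1 hg')⟩, huniq⟩,
    fun g hg v => ?_⟩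
  rw [huniq g hg]
  exact ⟨ReflectedEntropy.cutConfiguration_of_mem_left,
    ReflectedEntropy.cutConfiguration_of_mem_right htri.1.1.1.2.1,
    ReflectedEntropy.cutConfiguration_of_mem_diff,
    ReflectedEntropy.cutConfiguration_of_notMem hsub⟩
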